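/- Let $\mu$ be a probability measure on $(0,1)$ with $\int_0^1 \frac{1}{1-\beta}\,\mu(d\beta)<\infty$. Let $W=(W_x)_{x\ge 0}$ be a driftless subordinator (a Lévy process with nondecreasing paths, $W_0=0$) whose Lévy measure $\phi_W$ on $(0,\infty)$ is given by $$\phi_W(t,\infty)=\int_0^1 t^{-\beta}\,\mu(d\beta),\qquad t>0,$$ that is, $\mathbb E[e^{-sW_x}]=e^{-x\psi_W(s)}$ with $\psi_W(s)=\int_0^\infty (1-e^{-sy})\,\phi_W(dy)$ for $s>0$, $x\ge 0$. Let $E_t=\inf\{\tau\ge 0: W_\tau>t\}$ be its inverse, and for $t>0$, $x>0$ put $$g(t,x)=\int_0^t \phi_W(t-y,\infty)\,P_{W_x}(dy),$$ where $P_{W_x}$ is the law of $W_x$. For a function $u$ on $[0,\infty)$ and $0<\beta<1$ let $$\frac{\partial^\beta u(t)}{\partial t^\beta}=\frac{1}{\Gamma(1-\beta)}\int_0^t \frac{u'(r)}{(t-r)^\beta}\,dr$$ be the Caputo derivative, and let $$\mathbb D^{(\nu)}u(t)=\int_0^1 \frac{\partial^\beta u(t)}{\partial t^\beta}\,\nu(d\beta),\qquad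 \nu(d\beta)=\Gamma(1-\beta)\,\mu(d\beta),$$ be the distributed-order derivative. Then for every $\lambda>0$ the function $h(t,\lambda)=\mathbb E[e^{-\lambda E_t}]$ satisfies $$h(t,\lambda)=\int_0^\infty e^{-\lambda x}g(t,x)\,dx\quad (t>0),$$ and $$\mathbb D^{(\nu)}h(t,\lambda)=-\lambda\,h(t,\lambda)\quad (t>0),\qquad h(0,\lambda)=1.$$ Here $\mathbb D^{(\nu)}h(t,\lambda)$ exists in the classical sense for every $t>0$: $h(\cdot,\lambda)$ is continuous on $[0,t]$ and differentiable on $(0,t)$ with derivative integrable on $(0,t)$, and for every $\beta\in(0,1)$ the integral defining the Caputo derivative converges absolutely, as does the integral over $\beta$ with respect to $\nu$. -/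

import Mathlib

open scoped NNReal ENNReal

noncomputable section

namespace DistributedOrder

open MeasureTheory ProbabilityTheory Set

/-- `W` is a (driftless) subordinator with Lévy measure `φ` on the probability space `(Ω, P)`:
a Lévy process with nondecreasing paths, whose Laplace exponent is
`ψ(s) = ∫ (1 - e^{-s x}) φ(dx)`. The Lévy measure lives on `(0, ∞)` and integrates `min 1 x`. -/
structure IsSubordinator {Ω : Type*} [MeasurableSpace Ω] (P : Measure Ω)
    (W : ℝ≥0 → Ω → ℝ) (φ : Measure ℝ) : Prop where
  measurable : ∀ x, Measurable (W x)
  zero : ∀ᵐ ω ∂P, W 0 ω = 0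
  indep_increments : HasIndepIncrements W P
  stationary_increments : ∀ x y : ℝ≥0,
    IdentDistrib (fun ω => W (x + y) ω - W x ω) (W y) P P
  monotone : ∀ᵐ ω ∂P, Monotone (fun x => W x ω)
  right_continuous : ∀ᵐ ω ∂P, ∀ x : ℝ≥0, ContinuousWithinAt (fun y => W y ω) (Ici x) x
  levy_support : φ (Iic 0) = 0
  levy_integrable : ∫⁻ x, ENNReal.ofReal (min 1 x) ∂φ < ∞
  laplace : ∀ (x : ℝ≥0) (s : ℝ), 0 < s →
    ∫ ω, Real.exp (-s * W x ω) ∂P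
      = Real.exp (-(x : ℝ) * ∫ y, (1 - Real.exp (-s * y)) ∂φ)

/-- The inverse `E_t = inf {τ ≥ 0 : W_τ > t}`. The set is nonempty outside a null set when `W` is a
subordinator with nonzero Lévy measure, so the convention `sInf ∅ = 0` plays no role. -/
def inverse {Ω : Type*} (W : ℝ≥0 → Ω → ℝ) (t : ℝ) (ω : Ω) : ℝ :=
  ((sInf {τ : ℝ≥0 | t < W τ ω} : ℝ≥0) : ℝ)

/-- The Laplace transform `h(t, l) = E[exp (-l E_t)]` of the inverse. -/
def h {Ω : Type*} [MeasurableSpace Ω] (P : Measure Ω) (W : ℝ≥0 → Ω → ℝ) (t l : ℝ) : ℝ :=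
  ∫ ω, Real.exp (-l * inverse W t ω) ∂P

/-- The density `g(t, x) = ∫_0^t φ(t - y, ∞) P_{W(x)}(dy)` of the inverse. -/
def g {Ω : Type*} [MeasurableSpace Ω] (P : Measure Ω) (W : ℝ≥0 → Ω → ℝ) (φ : Measure ℝ)
    (t : ℝ) (x : ℝ≥0) : ℝ≥0∞ :=
  ∫⁻ y in Ico 0 t, φ (Ioi (t - y)) ∂(P.map (W x))

/-- The Caputo derivative of order `β ∈ (0, 1)`. -/
def caputoDeriv (β : ℝ) (u : ℝ → ℝ) (t : ℝ) : ℝ :=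
  1 / Real.Gamma (1 - β) * ∫ r in (0 : ℝ)..t, deriv u r / (t - r) ^ β

/-- The measure `ν(dβ) = Γ(1 - β) μ(dβ)`. -/
def orderMeasure (μ : Measure ℝ) : Measure ℝ :=
  μ.withDensity (fun β => ENNReal.ofReal (Real.Gamma (1 - β)))

/-- The distributed-order derivative with respect to a measure `ν` carried by `(0, 1)`. -/
def distributedDeriv (ν : Measure ℝ) (u : ℝ → ℝ) (t : ℝ) : ℝ :=
  ∫ β in Ioo (0 : ℝ) 1, caputoDeriv β u t ∂ν

/-- The distributed-order derivative of `u` at `t > 0` exists in the classical sense: `u` is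
continuous on `[0, t]`, differentiable on `(0, t)`, and all the integrals that define the
derivative converge absolutely. -/
structure DistributedDifferentiableAt (ν : Measure ℝ) (u : ℝ → ℝ) (t : ℝ) : Prop where
  continuousOn : ContinuousOn u (Icc 0 t)
  differentiableOn : ∀ r ∈ Ioo 0 t, DifferentiableAt ℝ u r
  integrable_deriv : IntervalIntegrable (deriv u) volume 0 t
  integrable_caputo : ∀ β ∈ Ioo (0 : ℝ) 1,
    IntervalIntegrable (fun r => deriv u r / (t - r) ^ β) volume 0 t
  integrable_order : IntegrableOn (fun β => caputoDeriv β u t) (Ioo 0 1) ν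

end DistributedOrder

end

/-! Everything rests on the potential measure `U(dy) = ∫_0^∞ e^{-lx} P_{W_x}(dy) dx`, whose Laplace
transform is `1 / (l + ψ(s))`. The form of the Lévy tail and a Gamma integral give `ψ(s) = ∫ s^β
ν(dβ)`.

The analytic point is that `U` has a density `u` which is continuous and nonincreasing on `(0, ∞)`.
Since `ν` lives on `(0, 1)`, `ψ` continues analytically to the plane cut along the negative axis,
and `l + ψ` has no zero there, even on the edges of the cut. With `s = e^z` the cut plane becomes
the strip `|Im z| ≤ π`. Cauchy's theorem on long rectangles then yields `1 / (l + ψ(s)) = ∫ ρ(dr) /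
(s + r)` with `ρ ≥ 0` (`integral_spectralDensity`, `exists_stieltjes_measure`). Hence `u(t) = ∫
e^{-tr} ρ(dr)`, by uniqueness of Laplace transforms (`measure_ext_of_laplace`).

Up to null sets, `{E_t > x} ⊆ {W_x ≤ t} ⊆ {E_t ≥ x}`, so `1 - h(t) = l U((-∞, t])` (`one_sub_h`). It
follows that `h(0) = 1` and `h' = -l u` on `(0, ∞)`. The Laplace transform of `h` is `s⁻¹ ψ / (l +
ψ)`, the product of those of the tail `φ(t, ∞)` and of `u`. So `h` is the convolution of the tail
with `u`, first almost everywhere and then everywhere by continuity (`ofReal_h_eq_convolution`).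

Both claims read off this convolution. Tonelli turns `∫ e^{-lx} g(t, x) dx` into it. In the
distributed-order derivative the factors `Γ(1 - β)` cancel and integrating `(t - r)^{-β}` over `μ`
rebuilds the tail, which leaves `-l` times the convolution. -/

namespace DistributedOrder

open MeasureTheory ProbabilityTheory Set

/-! ### Uniqueness of Laplace transforms -/

/-- Measures on the line with the same finite Laplace transform on `(0, ∞)` are equal. -/
theorem measure_ext_of_laplace {A B : Measure ℝ}
    (hA : ∀ s : ℝ, 0 < s → ∫⁻ y, ENNReal.ofReal (Real.exp (-s * y)) ∂A ≠ ∞)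
    (h : ∀ s : ℝ, 0 < s → ∫⁻ y, ENNReal.ofReal (Real.exp (-s * y)) ∂A
      = ∫⁻ y, ENNReal.ofReal (Real.exp (-s * y)) ∂B) : A = B := by
  -- Tilting by `e^{-y}` makes both measures finite and places the imaginary axis inside the
  -- half-plane `Re z < 1`, where the tilted moment generating functions are analytic.
  set w : ℝ → ℝ≥0∞ := fun y => ENNReal.ofReal (Real.exp (-1 * y)) with hw
  have hwm : Measurable w := by fun_prop
  have key : ∀ C : Measure ℝ, ∀ v : ℝ, ∫⁻ y, ENNReal.ofReal (Real.exp (v * y)) ∂(C.withDensity w)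
      = ∫⁻ y, ENNReal.ofReal (Real.exp (-(1 - v) * y)) ∂C := by
    intro C v
    rw [lintegral_withDensity_eq_lintegral_mul _ hwm (by fun_prop)]
    refine lintegral_congr fun y => ?_
    simp only [hw, Pi.mul_apply]
    rw [← ENNReal.ofReal_mul (Real.exp_nonneg _), ← Real.exp_add]
    congr 2; ring
  have hB : ∀ s : ℝ, 0 < s → ∫⁻ y, ENNReal.ofReal (Real.exp (-s * y)) ∂B ≠ ∞ :=
    fun s hs => h s hs ▸ hA s hs
  have hset : ∀ C : Measure ℝ,
      (∀ s : ℝ, 0 < s → ∫⁻ y, ENNReal.ofReal (Real.exp (-s * y)) ∂C ≠ ∞) →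
      Iio 1 ⊆ integrableExpSet id (C.withDensity w) := by
    intro C hC v hv
    refine ⟨by fun_prop, ?_⟩
    rw [hasFiniteIntegral_iff_ofReal (Filter.Eventually.of_forall fun _ => Real.exp_nonneg _)]
    simp only [id_eq]
    rw [key]
    exact (hC _ (by simpa using hv)).lt_top
  have hint : ∀ C : Measure ℝ,
      (∀ s : ℝ, 0 < s → ∫⁻ y, ENNReal.ofReal (Real.exp (-s * y)) ∂C ≠ ∞) →
      AnalyticOnNhd ℂ (complexMGF id (C.withDensity w)) {z | z.re < 1} := by
    intro C hC
    refine analyticOnNhd_complexMGF.mono fun z hz => ?_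
    exact interior_maximal (hset C hC) isOpen_Iio hz
  have hfin : ∀ C : Measure ℝ,
      (∀ s : ℝ, 0 < s → ∫⁻ y, ENNReal.ofReal (Real.exp (-s * y)) ∂C ≠ ∞) →
      IsFiniteMeasure (C.withDensity w) := fun C hC =>
    isFiniteMeasure_withDensity (hC 1 one_pos)
  have := hfin A hA
  have := hfin B hB
  have hmgf : ∀ v : ℝ, v < 1 →
      complexMGF id (A.withDensity w) v = complexMGF id (B.withDensity w) v := by
    intro v hv
    rw [complexMGF_ofReal, complexMGF_ofReal, mgf, mgf,
      integral_eq_lintegral_of_nonneg_ae (Filter.Eventually.of_forall fun _ => Real.exp_nonneg _)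
        (by fun_prop),
      integral_eq_lintegral_of_nonneg_ae (Filter.Eventually.of_forall fun _ => Real.exp_nonneg _)
        (by fun_prop)]
    simp only [id_eq]
    rw [key, key, h _ (by linarith)]
  -- Identity theorem: the two functions agree at real points accumulating at `0`. Restricted to the
  -- imaginary axis, the conclusion is equality of characteristic functions.
  have heq : EqOn (complexMGF id (A.withDensity w)) (complexMGF id (B.withDensity w))
      {z | z.re < 1} := by
    refine AnalyticOnNhd.eqOn_of_preconnected_of_frequently_eq (hint A hA) (hint B hB)
      (convex_halfSpace_re_lt 1).isPreconnected (z₀ := ((0 : ℝ) : ℂ)) (by simp) ?_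
    have hmap : Filter.Tendsto (fun x : ℝ => (x : ℂ)) (nhdsWithin 0 {0}ᶜ)
        (nhdsWithin ((0 : ℝ) : ℂ) {((0 : ℝ) : ℂ)}ᶜ) := by
      refine tendsto_nhdsWithin_of_tendsto_nhds_of_eventually_within _
        (Complex.continuous_ofReal.continuousWithinAt) ?_
      filter_upwards [self_mem_nhdsWithin] with x hx
      simpa using hx
    refine hmap.frequently (Filter.Eventually.frequently ?_)
    filter_upwards [nhdsWithin_le_nhds (Iio_mem_nhds (zero_lt_one (α := ℝ)))] with x hx
    exact hmgf x hx
  have hAB : A.withDensity w = B.withDensity w := by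
    refine Measure.ext_of_charFun (funext fun t => ?_)
    rw [← complexMGF_id_mul_I, ← complexMGF_id_mul_I]
    exact heq (by simp)
  have hinv : ∀ C : Measure ℝ, (C.withDensity w).withDensity (fun y => (w y)⁻¹) = C := by
    intro C
    refine withDensity_inv_same hwm (Filter.Eventually.of_forall fun y => ?_)
      (Filter.Eventually.of_forall fun y => ENNReal.ofReal_ne_top)
    simp only [hw, ne_eq, ENNReal.ofReal_eq_zero, not_le]
    exact Real.exp_pos _
  rw [← hinv A, hAB, hinv B]

/-- Functions on `(0, ∞)` with the same finite Laplace transform agree almost everywhere. -/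
theorem ae_eq_of_laplace {f k : ℝ → ℝ≥0∞} (hf : Measurable f) (hk : Measurable k)
    (hfin : ∀ s : ℝ, 0 < s → ∫⁻ t in Ioi 0, ENNReal.ofReal (Real.exp (-s * t)) * f t ≠ ∞)
    (h : ∀ s : ℝ, 0 < s → ∫⁻ t in Ioi 0, ENNReal.ofReal (Real.exp (-s * t)) * f t
      = ∫⁻ t in Ioi 0, ENNReal.ofReal (Real.exp (-s * t)) * k t) :
    f =ᵐ[volume.restrict (Ioi 0)] k := by
  rw [← withDensity_eq_iff_of_sigmaFinite hf.aemeasurable hk.aemeasurable]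
  have key : ∀ q : ℝ → ℝ≥0∞, Measurable q → ∀ s : ℝ,
      ∫⁻ t, ENNReal.ofReal (Real.exp (-s * t)) ∂((volume.restrict (Ioi 0)).withDensity q)
      = ∫⁻ t in Ioi 0, ENNReal.ofReal (Real.exp (-s * t)) * q t := by
    intro q hq s
    rw [lintegral_withDensity_eq_lintegral_mul _ hq (by fun_prop)]
    simp [mul_comm]
  refine measure_ext_of_laplace (fun s hs => ?_) (fun s hs => ?_)
  · rw [key f hf]; exact hfin s hs
  · rw [key f hf, key k hk]; exact h s hs

/-! ### Lower bounds for the denominator on the strip -/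

section Denominator

variable {ν : Measure ℝ}

theorem ae_mem_Ioo (hν : ν (Ioo 0 1)ᶜ = 0) : ∀ᵐ β ∂ν, β ∈ Ioo (0 : ℝ) 1 :=
  measure_eq_zero_iff_ae_notMem.1 hν |>.mono fun β hβ => by simpa using hβ

variable [IsFiniteMeasure ν]

theorem integrable_of_continuous (hν : ν (Ioo 0 1)ᶜ = 0) {E : Type*} [NormedAddCommGroup E]
    [SecondCountableTopologyEither ℝ E]
    {f : ℝ → E} (hf : Continuous f) : Integrable f ν := by
  obtain ⟨C, hC⟩ := isCompact_Icc.exists_bound_of_continuousOn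
    (hf.continuousOn (s := Icc (0 : ℝ) 1))
  refine Integrable.of_bound hf.aestronglyMeasurable C ?_
  filter_upwards [ae_mem_Ioo hν] with β hβ using hC β (Ioo_subset_Icc_self hβ)

theorem differentiable_complexMGF (hν : ν (Ioo 0 1)ᶜ = 0) :
    Differentiable ℂ (complexMGF id ν) := by
  have h : integrableExpSet id ν = univ := by
    refine eq_univ_of_forall fun t => ?_
    exact integrable_of_continuous hν (f := fun β => Real.exp (t * id β)) (by fun_prop)
  intro z
  exact (hasDerivAt_complexMGF (by simp [h])).differentiableAt

/-- The lower bound of the modulus of `a + ∫ e^{zβ} ν(dβ)` on the strip `|Im z| ≤ π`. -/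
noncomputable def stripBound (ν : Measure ℝ) (x : ℝ) : ℝ := ∫ β, Real.exp (x * β) * Real.sin (Real.pi * β) ∂ν

theorem sin_pi_mul_pos {β : ℝ} (hβ : β ∈ Ioo (0 : ℝ) 1) : 0 < Real.sin (Real.pi * β) :=
  Real.sin_pos_of_pos_of_lt_pi (mul_pos Real.pi_pos hβ.1)
    (by nlinarith [Real.pi_pos, hβ.2])

theorem re_complexMGF_mul (hν : ν (Ioo 0 1)ᶜ = 0) (z w : ℂ) :
    (w * complexMGF id ν z).re = ∫ β, (w * Complex.exp (z * β)).re ∂ν := by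
  rw [complexMGF, ← integral_const_mul]
  exact (integral_re (integrable_of_continuous hν
    (f := fun β : ℝ => w * Complex.exp (z * β)) (by fun_prop))).symm

/-- Rotating by `e^{-i Im z / 2}` centres the arguments: `e^{zβ}` acquires the argument `(β - 1/2)
Im z`, whose cosine is at least `cos(|β - 1/2| π) = sin(πβ)`, while the constant `a` keeps a
nonnegative real part. The modulus dominates the real part of the rotated sum. -/
theorem stripBound_le_norm (hν : ν (Ioo 0 1)ᶜ = 0) {a : ℝ} (ha : 0 ≤ a) {z : ℂ}
    (hz : |z.im| ≤ Real.pi) : stripBound ν z.re ≤ ‖(a : ℂ) + complexMGF id ν z‖ := by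
  have hz' := abs_le.1 hz
  set w : ℂ := Complex.exp (((-(z.im / 2) : ℝ) : ℂ) * Complex.I) with hw
  have hw1 : ‖w‖ = 1 := Complex.norm_exp_ofReal_mul_I _
  have h1 : (w * (a + complexMGF id ν z)).re ≤ ‖(a : ℂ) + complexMGF id ν z‖ := by
    refine (Complex.re_le_norm _).trans ?_
    rw [norm_mul, hw1, one_mul]
  refine le_trans ?_ h1
  rw [mul_add, Complex.add_re, re_complexMGF_mul hν]
  have h2 : 0 ≤ (w * a).re := by
    rw [hw, Complex.re_mul_ofReal, Complex.exp_ofReal_mul_I_re]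
    exact mul_nonneg (Real.cos_nonneg_of_neg_pi_div_two_le_of_le (by linarith) (by linarith)) ha
  refine le_trans ?_ (le_add_of_nonneg_left h2)
  refine integral_mono_ae (integrable_of_continuous hν (by fun_prop))
    (integrable_of_continuous hν (by fun_prop)) ?_
  filter_upwards [ae_mem_Ioo hν] with β hβ
  have h3 : (w * Complex.exp (z * β)).re
      = Real.exp (z.re * β) * Real.cos ((β - 1 / 2) * z.im) := by
    rw [hw, ← Complex.exp_add, Complex.exp_re]
    congr 2
    · simp
    · simp; ring
  rw [h3]
  refine mul_le_mul_of_nonneg_left ?_ (Real.exp_nonneg _)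
  have h4 : Real.sin (Real.pi * β) = Real.cos (|β - 1 / 2| * Real.pi) := by
    rw [← Real.cos_abs (( |β - 1 / 2|) * Real.pi), abs_mul, abs_abs, ← abs_mul, Real.cos_abs,
      ← Real.cos_pi_div_two_sub, ← Real.cos_neg]
    congr 1; ring
  rw [h4, ← Real.cos_abs ((β - 1 / 2) * z.im), abs_mul]
  have h5 : |β - 1 / 2| ≤ 1 / 2 := abs_le.2 ⟨by linarith [hβ.1], by linarith [hβ.2]⟩
  refine Real.cos_le_cos_of_nonneg_of_le_pi (by positivity) ?_ (by gcongr)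
  nlinarith [Real.pi_pos, abs_nonneg (β - 1 / 2)]

theorem integral_pos_of_pos_on_Ioo (hν : ν (Ioo 0 1)ᶜ = 0) (hν0 : ν ≠ 0) {f : ℝ → ℝ}
    (hf : Continuous f) (hpos : ∀ β ∈ Ioo (0 : ℝ) 1, 0 < f β) : 0 < ∫ β, f β ∂ν := by
  rw [integral_pos_iff_support_of_nonneg_ae]
  · refine pos_iff_ne_zero.2 fun h0 => hν0 (Measure.measure_univ_eq_zero.1 ?_)
    refine measure_mono_null (t := (Ioo 0 1)ᶜ ∪ Ioo 0 1) (by simp) ?_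
    exact measure_union_null hν (measure_mono_null (fun β hβ => (hpos β hβ).ne') h0)
  · filter_upwards [ae_mem_Ioo hν] with β hβ using (hpos β hβ).le
  · exact integrable_of_continuous hν hf

/-- The linear gain `x` makes the vertical edges of the contour negligible even if `ν` charges every
neighbourhood of `0` and `1`. It comes from `e^y ≥ 1 + y` with `y = xβ`, respectively `y = x(1 -
β)`; the weight `β(1 - β)` lies below both `β` and `1 - β`, so one constant serves both ends. -/
theorem exists_stripBound_ge (hν : ν (Ioo 0 1)ᶜ = 0) (hν0 : ν ≠ 0) :
    ∃ c : ℝ, 0 < c ∧ (∀ x, 0 < x → c * x ≤ stripBound ν x) ∧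
      ∀ x, 0 < x → c * x * Real.exp (-x) ≤ stripBound ν (-x) := by
  refine ⟨∫ β, β * (1 - β) * Real.sin (Real.pi * β) ∂ν, ?_, fun x hx => ?_, fun x hx => ?_⟩
  · exact integral_pos_of_pos_on_Ioo hν hν0 (by fun_prop) fun β hβ =>
      mul_pos (mul_pos hβ.1 (by linarith [hβ.2])) (sin_pi_mul_pos hβ)
  · rw [← integral_mul_const]
    refine integral_mono_ae (integrable_of_continuous hν (by fun_prop))
      (integrable_of_continuous hν (by fun_prop)) ?_
    filter_upwards [ae_mem_Ioo hν] with β hβ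
    have h1 := sin_pi_mul_pos hβ
    have h2 := Real.add_one_le_exp (x * β)
    have h3 : β * (1 - β) * x ≤ Real.exp (x * β) := by nlinarith [mul_pos hβ.1 hx, hβ.1, hβ.2]
    nlinarith
  · rw [← integral_mul_const, ← integral_mul_const]
    refine integral_mono_ae (integrable_of_continuous hν (by fun_prop))
      (integrable_of_continuous hν (by fun_prop)) ?_
    filter_upwards [ae_mem_Ioo hν] with β hβ
    have h1 := sin_pi_mul_pos hβ
    have h2 := Real.add_one_le_exp (x * (1 - β))
    have h3 : β * (1 - β) * x ≤ Real.exp (x * (1 - β)) := by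
      nlinarith [mul_pos (sub_pos.2 hβ.2) hx, hβ.1, hβ.2]
    have h4 : Real.exp (-x * β) = Real.exp (x * (1 - β)) * Real.exp (-x) := by
      rw [← Real.exp_add]; congr 1; ring
    rw [h4]
    nlinarith [mul_le_mul_of_nonneg_right h3 (mul_pos h1 (Real.exp_pos (-x))).le]

theorem stripBound_pos (hν : ν (Ioo 0 1)ᶜ = 0) (hν0 : ν ≠ 0) (x : ℝ) : 0 < stripBound ν x :=
  integral_pos_of_pos_on_Ioo hν hν0 (by fun_prop) fun _ hβ =>
    mul_pos (Real.exp_pos _) (sin_pi_mul_pos hβ)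

end Denominator

/-! ### The resolvent on the strip and its contour integral -/

section Resolvent

variable {ν : Measure ℝ}

/-- The function `1 / (a + ∫ e^{zβ} ν(dβ))` on the strip `|Im z| ≤ π`. -/
noncomputable def stripResolvent (ν : Measure ℝ) (a : ℝ) (z : ℂ) : ℂ :=
  ((a : ℂ) + complexMGF id ν z)⁻¹

/-- The boundary density `-π⁻¹ Im (1 / (a + ∫ e^{(x + iπ)β} ν(dβ)))`. -/
noncomputable def spectralDensity (ν : Measure ℝ) (a x : ℝ) : ℝ :=
  -(stripResolvent ν a (x + Real.pi * Complex.I)).im / Real.pi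

theorem stripResolvent_conj (a : ℝ) (z : ℂ) :
    stripResolvent ν a (starRingEnd ℂ z) = starRingEnd ℂ (stripResolvent ν a z) := by
  have h : complexMGF id ν (starRingEnd ℂ z) = starRingEnd ℂ (complexMGF id ν z) := by
    rw [complexMGF, complexMGF, ← integral_conj]
    refine integral_congr_ae (Filter.Eventually.of_forall fun β => ?_)
    simp [← Complex.exp_conj]
  simp [stripResolvent, h]

theorem stripResolvent_ofReal (a x : ℝ) :
    stripResolvent ν a x = (((a + mgf id ν x)⁻¹ : ℝ) : ℂ) := by
  rw [stripResolvent, complexMGF_ofReal]; push_cast; rfl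

/-- The integrand of the contour integral, with its singularity at `log s` removed. -/
noncomputable def contourIntegrand (ν : Measure ℝ) (a p : ℝ) (z : ℂ) : ℂ :=
  dslope (stripResolvent ν a) p z / dslope Complex.exp p z * Complex.exp z

theorem contourIntegrand_eq (a p : ℝ) {z : ℂ} (hz : Complex.exp z ≠ Complex.exp p) :
    contourIntegrand ν a p z = (stripResolvent ν a z - stripResolvent ν a p) * Complex.exp z
      / (Complex.exp z - Complex.exp p) := by
  have hzp : z ≠ p := fun h => hz (h ▸ rfl)
  rw [contourIntegrand, dslope_of_ne _ hzp, dslope_of_ne _ hzp, slope_def_field, slope_def_field]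
  have h1 := sub_ne_zero.2 hz
  have h2 := sub_ne_zero.2 hzp
  field_simp

variable [IsFiniteMeasure ν]

theorem add_complexMGF_ne_zero (hν : ν (Ioo 0 1)ᶜ = 0) (hν0 : ν ≠ 0) {a : ℝ} (ha : 0 ≤ a) {z : ℂ}
    (hz : |z.im| ≤ Real.pi) : (a : ℂ) + complexMGF id ν z ≠ 0 :=
  norm_pos_iff.1 ((stripBound_pos hν hν0 z.re).trans_le (stripBound_le_norm hν ha hz))

theorem norm_stripResolvent_le (hν : ν (Ioo 0 1)ᶜ = 0) (hν0 : ν ≠ 0) {a : ℝ} (ha : 0 ≤ a) {z : ℂ}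
    (hz : |z.im| ≤ Real.pi) : ‖stripResolvent ν a z‖ ≤ (stripBound ν z.re)⁻¹ := by
  rw [stripResolvent, norm_inv]
  exact inv_anti₀ (stripBound_pos hν hν0 z.re) (stripBound_le_norm hν ha hz)

theorem differentiableAt_stripResolvent (hν : ν (Ioo 0 1)ᶜ = 0) (hν0 : ν ≠ 0) {a : ℝ} (ha : 0 ≤ a)
    {z : ℂ} (hz : |z.im| ≤ Real.pi) : DifferentiableAt ℂ (stripResolvent ν a) z :=
  ((differentiable_complexMGF hν z).const_add _).inv (add_complexMGF_ne_zero hν hν0 ha hz)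

theorem abs_im_add_pi (x : ℝ) : |((x : ℂ) + Real.pi * Complex.I).im| ≤ Real.pi := by
  simp [abs_of_pos Real.pi_pos]

theorem continuous_spectralDensity (hν : ν (Ioo 0 1)ᶜ = 0) (hν0 : ν ≠ 0) {a : ℝ} (ha : 0 ≤ a) :
    Continuous (spectralDensity ν a) := by
  refine Continuous.div_const (Continuous.neg (Complex.continuous_im.comp ?_)) _
  refine continuous_iff_continuousAt.2 fun x => ?_
  exact ContinuousAt.comp (f := fun x : ℝ => (x : ℂ) + Real.pi * Complex.I)
    (differentiableAt_stripResolvent hν hν0 ha (abs_im_add_pi x)).continuousAt (by fun_prop)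

/-- On the upper edge `Im e^{(x + iπ)β} = e^{xβ} sin(πβ)` is positive for `β` in `(0, 1)`, and
inversion reverses the sign of the imaginary part. -/
theorem spectralDensity_nonneg (hν : ν (Ioo 0 1)ᶜ = 0) (a x : ℝ) :
    0 ≤ spectralDensity ν a x := by
  have h : 0 ≤ (complexMGF id ν (x + Real.pi * Complex.I)).im := by
    have h1 := re_complexMGF_mul hν (x + Real.pi * Complex.I) (-Complex.I)
    have h2 : (-Complex.I * complexMGF id ν (x + Real.pi * Complex.I)).re
      = (complexMGF id ν (x + Real.pi * Complex.I)).im := by simp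
    rw [← h2, h1]
    refine integral_nonneg_of_ae ?_
    filter_upwards [ae_mem_Ioo hν] with β hβ
    have h3 : (-Complex.I * Complex.exp ((x + Real.pi * Complex.I) * β)).re
        = Real.exp (x * β) * Real.sin (Real.pi * β) := by
      simp [Complex.exp_im]
    rw [h3]
    exact (mul_pos (Real.exp_pos _) (sin_pi_mul_pos hβ)).le
  refine div_nonneg ?_ Real.pi_pos.le
  rw [stripResolvent, Complex.inv_im, neg_div, neg_neg]
  exact div_nonneg (by simpa using h) (Complex.normSq_nonneg _)

theorem eq_of_exp_eq_exp_ofReal {p : ℝ} {z : ℂ} (hz : |z.im| ≤ Real.pi)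
    (h : Complex.exp z = Complex.exp p) : z = p := by
  obtain ⟨n, hn⟩ := Complex.exp_eq_exp_iff_exists_int.1 h
  have him := congrArg Complex.im hn
  have hre := congrArg Complex.re hn
  simp at him hre
  have hn0 : n = 0 := by
    have hz' := abs_le.1 hz
    have h1 : (n : ℝ) < 1 := by nlinarith [Real.pi_pos]
    have h2 : (-1 : ℝ) < n := by nlinarith [Real.pi_pos]
    have h3 : n < 1 := by exact_mod_cast h1
    have h4 : -1 < n := by exact_mod_cast h2
    omega
  simpa [hn0] using hn

theorem dslope_exp_ne_zero {p : ℝ} {z : ℂ} (hz : |z.im| ≤ Real.pi) :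
    dslope Complex.exp p z ≠ 0 := by
  by_cases hzp : z = p
  · rw [hzp, dslope_same, Complex.deriv_exp]; exact Complex.exp_ne_zero _
  · rw [dslope_of_ne _ hzp, slope_def_field]
    exact div_ne_zero (sub_ne_zero.2 fun h => hzp (eq_of_exp_eq_exp_ofReal hz h))
      (sub_ne_zero.2 hzp)

theorem differentiableAt_contourIntegrand (hν : ν (Ioo 0 1)ᶜ = 0) (hν0 : ν ≠ 0) {a p : ℝ}
    (ha : 0 ≤ a) {z : ℂ} (hz : |z.im| ≤ Real.pi) (hzp : z ≠ p) :
    DifferentiableAt ℂ (contourIntegrand ν a p) z := by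
  refine DifferentiableAt.mul (DifferentiableAt.div ?_ ?_ (dslope_exp_ne_zero hz))
    Complex.differentiableAt_exp
  · exact (differentiableAt_dslope_of_ne hzp).2 (differentiableAt_stripResolvent hν hν0 ha hz)
  · exact (differentiableAt_dslope_of_ne hzp).2 Complex.differentiableAt_exp

theorem continuousAt_contourIntegrand (hν : ν (Ioo 0 1)ᶜ = 0) (hν0 : ν ≠ 0) {a p : ℝ}
    (ha : 0 ≤ a) {z : ℂ} (hz : |z.im| ≤ Real.pi) :
    ContinuousAt (contourIntegrand ν a p) z := by
  by_cases hzp : z = p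
  · subst hzp
    refine ContinuousAt.mul (ContinuousAt.div ?_ ?_ (dslope_exp_ne_zero hz))
      Complex.continuous_exp.continuousAt
    · exact continuousAt_dslope_same.2 (differentiableAt_stripResolvent hν hν0 ha hz)
    · exact continuousAt_dslope_same.2 Complex.differentiableAt_exp
  · exact (differentiableAt_contourIntegrand hν hν0 ha hz hzp).continuousAt

/-- On both lines `Im z = ±π` one has `e^z = -e^x`, so the kernels coincide and the subtracted
constant cancels between the edges. What remains is the jump of the resolvent, which by conjugation
symmetry is `2πi` times the spectral density. -/
theorem contour_identity (hν : ν (Ioo 0 1)ᶜ = 0) (hν0 : ν ≠ 0) {a : ℝ} (ha : 0 ≤ a) (p R : ℝ) :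
    ((∫ x in -R..R, spectralDensity ν a x * (Real.exp x / (Real.exp x + Real.exp p)) : ℝ) : ℂ)
      = ((∫ y in -Real.pi..Real.pi, contourIntegrand ν a p (((-R : ℝ) : ℂ) + y * Complex.I))
        - ∫ y in -Real.pi..Real.pi, contourIntegrand ν a p ((R : ℂ) + y * Complex.I))
        / (2 * Real.pi) := by
  have hpi := Real.pi_pos
  have hle : -Real.pi ≤ Real.pi := by linarith
  -- Cauchy's theorem allows a countable exceptional set, so at the removed pole `p` continuity is
  -- enough.
  have hmain := Complex.integral_boundary_rect_eq_zero_of_differentiable_on_off_countable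
    (contourIntegrand ν a p) ⟨-R, -Real.pi⟩ ⟨R, Real.pi⟩ {(p : ℂ)} (countable_singleton _) ?_ ?_
  rotate_left
  · intro z hz
    refine (continuousAt_contourIntegrand hν hν0 ha ?_).continuousWithinAt
    have h := hz.2
    simp only [mem_preimage, uIcc_of_le hle] at h
    exact abs_le.2 h
  · intro z hz
    refine differentiableAt_contourIntegrand hν hν0 ha ?_ hz.2
    have h := hz.1.2
    simp only [mem_preimage, min_eq_left hle, max_eq_right hle] at h
    exact abs_le.2 ⟨h.1.le, h.2.le⟩
  simp only at hmain
  have hedge : ∀ (x σ : ℝ), Complex.exp (σ * Complex.I) = -1 →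
      contourIntegrand ν a p (x + σ * Complex.I)
      = (stripResolvent ν a (x + σ * Complex.I) - stripResolvent ν a p)
        * ((Real.exp x / (Real.exp x + Real.exp p) : ℝ) : ℂ) := by
    intro x σ hσ
    have he : Complex.exp (x + σ * Complex.I) = -(Real.exp x : ℝ) := by
      rw [Complex.exp_add, hσ]; push_cast; ring
    have hpos : 0 < Real.exp x + Real.exp p := by positivity
    have hne : (Complex.exp x + Complex.exp p) ≠ 0 := by
      have := Complex.ofReal_ne_zero.2 hpos.ne'
      push_cast at this; exact this
    have hsub : Complex.exp (x + σ * Complex.I) - Complex.exp p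
        = -(Complex.exp x + Complex.exp p) := by rw [he]; push_cast; ring
    rw [contourIntegrand_eq, hsub, he]
    · push_cast; field_simp
    · exact sub_ne_zero.1 (hsub ▸ neg_ne_zero.2 hne)
  have htop : Complex.exp ((Real.pi : ℝ) * Complex.I) = -1 := Complex.exp_pi_mul_I
  have hbot : Complex.exp (((-Real.pi : ℝ) : ℂ) * Complex.I) = -1 := by
    push_cast; rw [neg_mul, Complex.exp_neg, Complex.exp_pi_mul_I]; norm_num
  have hcont : ∀ σ : ℝ, |σ| ≤ Real.pi → IntervalIntegrable
      (fun x : ℝ => contourIntegrand ν a p (x + σ * Complex.I)) volume (-R) R := by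
    intro σ hσ
    refine Continuous.intervalIntegrable (continuous_iff_continuousAt.2 fun x => ?_) _ _
    exact ContinuousAt.comp (f := fun x : ℝ => (x : ℂ) + σ * Complex.I)
      (continuousAt_contourIntegrand hν hν0 ha (by simpa using hσ)) (by fun_prop)
  rw [← intervalIntegral.integral_sub (hcont _ (by simp [abs_of_pos hpi]))
    (hcont _ (by simp [abs_of_pos hpi]))] at hmain
  have hdiff : (∫ x in -R..R, (contourIntegrand ν a p (x + ((-Real.pi : ℝ) : ℂ) * Complex.I)
      - contourIntegrand ν a p (x + (Real.pi : ℂ) * Complex.I)))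
      = (2 * Real.pi * Complex.I) * ((∫ x in -R..R, spectralDensity ν a x *
        (Real.exp x / (Real.exp x + Real.exp p)) : ℝ) : ℂ) := by
    rw [← intervalIntegral.integral_ofReal, ← intervalIntegral.integral_const_mul]
    refine intervalIntegral.integral_congr fun x _ => ?_
    rw [hedge x _ hbot, hedge x _ htop]
    have hconj : (x : ℂ) + ((-Real.pi : ℝ) : ℂ) * Complex.I
        = starRingEnd ℂ ((x : ℂ) + Real.pi * Complex.I) := by simp
    rw [hconj, stripResolvent_conj]
    set z := stripResolvent ν a ((x : ℂ) + Real.pi * Complex.I) with hz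
    have h2 : starRingEnd ℂ z - z = -(2 * z.im * Complex.I) := by
      apply Complex.ext <;> simp <;> ring
    rw [← sub_mul, sub_sub_sub_cancel_right, h2, spectralDensity, ← hz]
    have hpc : (Real.pi : ℂ) ≠ 0 := Complex.ofReal_ne_zero.2 hpi.ne'
    push_cast
    field_simp
  rw [hdiff] at hmain
  simp only [smul_eq_mul] at hmain
  have hpc : (Real.pi : ℂ) ≠ 0 := Complex.ofReal_ne_zero.2 hpi.ne'
  rw [eq_div_iff (by simp)]
  have hI := Complex.I_ne_zero
  refine mul_left_cancel₀ hI ?_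
  linear_combination hmain

end Resolvent

/-! ### Limits of the vertical edges and the Stieltjes representation -/

section Spectral

variable {ν : Measure ℝ} [IsFiniteMeasure ν]

/-- The resolvent is only controlled by `e^R / (cR)` here, but the factor `e^z` has modulus
`e^{-R}`, and `|e^z - e^p|` stays above `e^p / 2`. -/
theorem tendsto_contour_left (hν : ν (Ioo 0 1)ᶜ = 0) (hν0 : ν ≠ 0) {a : ℝ} (ha : 0 ≤ a) (p : ℝ) :
    Filter.Tendsto (fun R : ℝ => ∫ y in -Real.pi..Real.pi,
      contourIntegrand ν a p (((-R : ℝ) : ℂ) + y * Complex.I)) Filter.atTop (nhds 0) := by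
  obtain ⟨c, hc, -, hc2⟩ := exists_stripBound_ge hν hν0
  have hpi := Real.pi_pos
  set N := ‖stripResolvent ν a p‖ with hN
  have hlim : Filter.Tendsto (fun R : ℝ => ((c⁻¹ * R⁻¹ + N * Real.exp (-R))
      * (2 / Real.exp p)) * |Real.pi - -Real.pi|) Filter.atTop (nhds 0) := by
    have h1 : Filter.Tendsto (fun R : ℝ => ((c⁻¹ * R⁻¹ + N * Real.exp (-R))
      * (2 / Real.exp p)) * |Real.pi - -Real.pi|) Filter.atTop
      (nhds (((c⁻¹ * 0 + N * 0) * (2 / Real.exp p)) * |Real.pi - -Real.pi|)) :=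
      (((tendsto_inv_atTop_zero.const_mul _).add
        (Real.tendsto_exp_neg_atTop_nhds_zero.const_mul _)).mul_const _).mul_const _
    simpa using h1
  refine squeeze_zero_norm' ?_ hlim
  have hev : ∀ᶠ R : ℝ in Filter.atTop, Real.exp (-R) < Real.exp p / 2 :=
    Real.tendsto_exp_neg_atTop_nhds_zero.eventually_lt_const (by positivity)
  filter_upwards [hev, Filter.eventually_gt_atTop 0] with R hR hR0
  refine intervalIntegral.norm_integral_le_of_norm_le_const fun y hy => ?_
  rw [uIoc_of_le (by linarith)] at hy
  set z : ℂ := ((-R : ℝ) : ℂ) + y * Complex.I with hz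
  have hre : z.re = -R := by simp [hz]
  have him : |z.im| ≤ Real.pi := by
    have : z.im = y := by simp [hz]
    rw [this]; exact abs_le.2 ⟨hy.1.le, hy.2⟩
  have hexp : ‖Complex.exp z‖ = Real.exp (-R) := by rw [Complex.norm_exp, hre]
  have hp : ‖Complex.exp p‖ = Real.exp p := by rw [Complex.norm_exp, Complex.ofReal_re]
  have hden : Real.exp p / 2 ≤ ‖Complex.exp z - Complex.exp p‖ := by
    have := norm_sub_norm_le (Complex.exp p) (Complex.exp z)
    rw [norm_sub_rev, hexp, hp] at this
    linarith
  have hden0 : 0 < Real.exp p / 2 := by positivity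
  rw [contourIntegrand_eq a p (sub_ne_zero.1 (norm_pos_iff.1 (hden0.trans_le hden))),
    norm_div, norm_mul, hexp, div_eq_mul_inv]
  have hinv : ‖Complex.exp z - Complex.exp p‖⁻¹ ≤ 2 / Real.exp p := by
    rw [← inv_div]; exact inv_anti₀ hden0 hden
  have hF := norm_stripResolvent_le hν hν0 ha him
  rw [hre] at hF
  have hF2 : ‖stripResolvent ν a z‖ * Real.exp (-R) ≤ c⁻¹ * R⁻¹ := by
    have h3 : (stripBound ν (-R))⁻¹ ≤ (c * R * Real.exp (-R))⁻¹ :=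
      inv_anti₀ (by positivity) (hc2 R hR0)
    calc ‖stripResolvent ν a z‖ * Real.exp (-R)
        ≤ (c * R * Real.exp (-R))⁻¹ * Real.exp (-R) :=
          mul_le_mul_of_nonneg_right (hF.trans h3) (Real.exp_nonneg _)
      _ = c⁻¹ * R⁻¹ := by field_simp
  refine mul_le_mul ?_ hinv (by positivity) (by positivity)
  calc ‖stripResolvent ν a z - stripResolvent ν a p‖ * Real.exp (-R)
      ≤ (‖stripResolvent ν a z‖ + N) * Real.exp (-R) :=
        mul_le_mul_of_nonneg_right (norm_sub_le _ _) (Real.exp_nonneg _)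
    _ ≤ c⁻¹ * R⁻¹ + N * Real.exp (-R) := by rw [add_mul]; linarith

/-- As `Re z → ∞` the resolvent vanishes and `e^z / (e^z - e^p) → 1`, so the integrand tends to
minus the resolvent at `p` along an edge of length `2π`. This limit recovers the value removed with
the pole. -/
theorem tendsto_contour_right (hν : ν (Ioo 0 1)ᶜ = 0) (hν0 : ν ≠ 0) {a : ℝ} (ha : 0 ≤ a) (p : ℝ) :
    Filter.Tendsto (fun R : ℝ => ∫ y in -Real.pi..Real.pi,
      contourIntegrand ν a p ((R : ℂ) + y * Complex.I)) Filter.atTop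
      (nhds (-(2 * Real.pi * stripResolvent ν a p))) := by
  obtain ⟨c, hc, hc1, -⟩ := exists_stripBound_ge hν hν0
  have hpi := Real.pi_pos
  set N := ‖stripResolvent ν a p‖ with hN
  have hlim : Filter.Tendsto (fun R : ℝ => (2 * c⁻¹ * R⁻¹ + 2 * N * Real.exp p * Real.exp (-R))
      * |Real.pi - -Real.pi|) Filter.atTop (nhds 0) := by
    have h1 : Filter.Tendsto (fun R : ℝ => (2 * c⁻¹ * R⁻¹ + 2 * N * Real.exp p * Real.exp (-R))
      * |Real.pi - -Real.pi|) Filter.atTop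
      (nhds ((2 * c⁻¹ * 0 + 2 * N * Real.exp p * 0) * |Real.pi - -Real.pi|)) :=
      (((tendsto_inv_atTop_zero.const_mul _).add
        (Real.tendsto_exp_neg_atTop_nhds_zero.const_mul _)).mul_const _)
    simpa using h1
  rw [tendsto_iff_norm_sub_tendsto_zero]
  refine squeeze_zero' (Filter.Eventually.of_forall fun _ => norm_nonneg _) ?_ hlim
  have hev : ∀ᶠ R : ℝ in Filter.atTop, 2 * Real.exp p < Real.exp R :=
    Real.tendsto_exp_atTop.eventually_gt_atTop _
  filter_upwards [hev, Filter.eventually_gt_atTop 0] with R hR hR0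
  have hconst : -(2 * (Real.pi : ℂ) * stripResolvent ν a p)
      = -∫ _ in -Real.pi..Real.pi, stripResolvent ν a p := by
    rw [intervalIntegral.integral_const]
    simp only [Complex.real_smul]
    push_cast; ring
  have hcont : ContinuousOn (fun y : ℝ => contourIntegrand ν a p ((R : ℂ) + y * Complex.I))
      (uIcc (-Real.pi) Real.pi) := by
    intro y hy
    rw [uIcc_of_le (by linarith)] at hy
    refine ContinuousAt.continuousWithinAt ?_
    exact ContinuousAt.comp (f := fun y : ℝ => (R : ℂ) + y * Complex.I)
      (continuousAt_contourIntegrand hν hν0 ha (by simpa using abs_le.2 hy)) (by fun_prop)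
  rw [hconst, sub_neg_eq_add, ← intervalIntegral.integral_add hcont.intervalIntegrable (by simp)]
  refine intervalIntegral.norm_integral_le_of_norm_le_const fun y hy => ?_
  rw [uIoc_of_le (by linarith)] at hy
  set z : ℂ := (R : ℂ) + y * Complex.I with hz
  have hre : z.re = R := by simp [hz]
  have him : |z.im| ≤ Real.pi := by
    have : z.im = y := by simp [hz]
    rw [this]; exact abs_le.2 ⟨hy.1.le, hy.2⟩
  have hexp : ‖Complex.exp z‖ = Real.exp R := by rw [Complex.norm_exp, hre]
  have hp : ‖Complex.exp p‖ = Real.exp p := by rw [Complex.norm_exp, Complex.ofReal_re]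
  have hden : Real.exp R / 2 ≤ ‖Complex.exp z - Complex.exp p‖ := by
    have := norm_sub_norm_le (Complex.exp z) (Complex.exp p)
    rw [hexp, hp] at this
    linarith
  have hden0 : 0 < Real.exp R / 2 := by positivity
  have hne := norm_pos_iff.1 (hden0.trans_le hden)
  have hsum : contourIntegrand ν a p z + stripResolvent ν a p
      = (stripResolvent ν a z * Complex.exp z - stripResolvent ν a p * Complex.exp p)
        / (Complex.exp z - Complex.exp p) := by
    rw [contourIntegrand_eq a p (sub_ne_zero.1 hne)]
    field_simp; ring
  rw [hsum, norm_div, div_le_iff₀ (norm_pos_iff.2 hne)]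
  have hF := norm_stripResolvent_le hν hν0 ha him
  rw [hre] at hF
  have hF2 : ‖stripResolvent ν a z‖ ≤ c⁻¹ * R⁻¹ := by
    refine hF.trans ((inv_anti₀ (by positivity) (hc1 R hR0)).trans ?_)
    rw [mul_inv]
  have hnum : ‖stripResolvent ν a z * Complex.exp z - stripResolvent ν a p * Complex.exp p‖
      ≤ c⁻¹ * R⁻¹ * Real.exp R + N * Real.exp p := by
    refine (norm_sub_le _ _).trans ?_
    rw [norm_mul, norm_mul, hexp, hp]
    gcongr
  refine hnum.trans (le_trans (le_of_eq ?_) (mul_le_mul_of_nonneg_left hden (by positivity)))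
  have : Real.exp (-R) * Real.exp R = 1 := by rw [← Real.exp_add]; simp
  linear_combination (-N * Real.exp p) * this

/-- The Stieltjes representation of `1 / (a + ∫ s^β ν(dβ))`, with `s = e^p`. -/
theorem integral_spectralDensity (hν : ν (Ioo 0 1)ᶜ = 0) (hν0 : ν ≠ 0) {a : ℝ} (ha : 0 ≤ a)
    (p : ℝ) :
    Integrable (fun x => spectralDensity ν a x * (Real.exp x / (Real.exp x + Real.exp p))) ∧
    ∫ x, spectralDensity ν a x * (Real.exp x / (Real.exp x + Real.exp p))
      = (a + mgf id ν p)⁻¹ := by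
  set q : ℝ → ℝ := fun x => spectralDensity ν a x * (Real.exp x / (Real.exp x + Real.exp p))
    with hq
  have hpos : ∀ x, 0 < Real.exp x + Real.exp p := fun x => by positivity
  have hqc : Continuous q := (continuous_spectralDensity hν hν0 ha).mul
    (Real.continuous_exp.div (by fun_prop) fun x => (hpos x).ne')
  have hq0 : ∀ x, 0 ≤ q x := fun x => mul_nonneg (spectralDensity_nonneg hν a x)
    (div_nonneg (Real.exp_nonneg _) (hpos x).le)
  have hlim : Filter.Tendsto (fun R : ℝ => ∫ x in -R..R, q x) Filter.atTop
      (nhds (a + mgf id ν p)⁻¹) := by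
    have h1 := ((tendsto_contour_left hν hν0 ha p).sub
      (tendsto_contour_right hν hν0 ha p)).div_const (2 * (Real.pi : ℂ))
    have h2 : (0 - -(2 * (Real.pi : ℂ) * stripResolvent ν a p)) / (2 * (Real.pi : ℂ))
        = (((a + mgf id ν p)⁻¹ : ℝ) : ℂ) := by
      rw [← stripResolvent_ofReal]
      have hpc : (Real.pi : ℂ) ≠ 0 := Complex.ofReal_ne_zero.2 Real.pi_pos.ne'
      field_simp; ring
    rw [h2] at h1
    have h3 := (Complex.continuous_re.tendsto _).comp h1
    rw [Complex.ofReal_re] at h3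
    refine h3.congr fun R => ?_
    simp only [Function.comp_apply]
    rw [← contour_identity hν hν0 ha p R, Complex.ofReal_re]
  -- Since `q ≥ 0`, convergence over the symmetric intervals already gives integrability.
  have hint : Integrable q := by
    refine integrable_of_intervalIntegral_norm_tendsto _
      (fun R : ℝ => (hqc.integrableOn_Icc (a := -R) (b := R)).mono_set Ioc_subset_Icc_self)
      Filter.tendsto_neg_atTop_atBot Filter.tendsto_id (hlim.congr fun R => ?_)
    exact intervalIntegral.integral_congr fun x _ => (Real.norm_of_nonneg (hq0 x)).symm
  exact ⟨hint, tendsto_nhds_unique (intervalIntegral_tendsto_integral hint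
    Filter.tendsto_neg_atTop_atBot Filter.tendsto_id) hlim⟩

end Spectral

/-! ### From the Stieltjes measure to a nonincreasing density -/

theorem lintegral_exp_neg_mul_Ioi {s : ℝ} (hs : 0 < s) :
    ∫⁻ t in Ioi (0 : ℝ), ENNReal.ofReal (Real.exp (-s * t)) = ENNReal.ofReal s⁻¹ := by
  rw [← ofReal_integral_eq_lintegral_ofReal (integrableOn_exp_mul_Ioi (neg_lt_zero.2 hs) 0)
    (Filter.Eventually.of_forall fun _ => Real.exp_nonneg _),
    integral_exp_mul_Ioi (neg_lt_zero.2 hs)]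
  congr 1
  simp

/-- Substituting `r = e^x` and `p = log s` turns `e^x / (e^x + e^p) dx` into `dr / (r + s)`; `ρ` is
the image of the spectral density with its factor `e^x`. -/
theorem exists_stieltjes_measure {ν : Measure ℝ} [IsFiniteMeasure ν] (hν : ν (Ioo 0 1)ᶜ = 0)
    (hν0 : ν ≠ 0) {a : ℝ} (ha : 0 ≤ a) :
    ∃ ρ : Measure ℝ, SFinite ρ ∧ (∀ᵐ r ∂ρ, 0 < r) ∧ ∀ s : ℝ, 0 < s →
      ∫⁻ r, ENNReal.ofReal (s + r)⁻¹ ∂ρ = ENNReal.ofReal (a + ∫ β, s ^ β ∂ν)⁻¹ := by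
  have hm : Measurable fun x => ENNReal.ofReal (spectralDensity ν a x * Real.exp x) :=
    (((continuous_spectralDensity hν hν0 ha).mul Real.continuous_exp).measurable).ennreal_ofReal
  refine ⟨(volume.withDensity fun x => ENNReal.ofReal (spectralDensity ν a x * Real.exp x)).map
    Real.exp, inferInstance, ?_, fun s hs => ?_⟩
  · rw [ae_map_iff Real.measurable_exp.aemeasurable measurableSet_Ioi]
    exact Filter.Eventually.of_forall Real.exp_pos
  · have hI := integral_spectralDensity hν hν0 ha (Real.log s)
    rw [Real.exp_log hs] at hI
    have hmgf : mgf id ν (Real.log s) = ∫ β, s ^ β ∂ν := by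
      rw [mgf]
      exact integral_congr_ae (Filter.Eventually.of_forall fun β =>
        (Real.rpow_def_of_pos hs β).symm)
    rw [lintegral_map (by fun_prop) Real.measurable_exp,
      lintegral_withDensity_eq_lintegral_mul _ hm (by fun_prop), ← hmgf, ← hI.2,
      ofReal_integral_eq_lintegral_ofReal hI.1 (Filter.Eventually.of_forall fun x =>
        mul_nonneg (spectralDensity_nonneg hν a x) (by positivity))]
    refine lintegral_congr fun x => ?_
    have hk := spectralDensity_nonneg hν a x
    simp only [Pi.mul_apply]
    rw [← ENNReal.ofReal_mul (by positivity)]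
    congr 1
    rw [div_eq_mul_inv, add_comm s, mul_assoc]

/-- The reciprocal `1 / (a + ∫ s^β ν(dβ))` is the Laplace transform of a nonincreasing function
that is continuous on `(0, ∞)`. -/
theorem exists_resolvent_density {ν : Measure ℝ} [IsFiniteMeasure ν] (hν : ν (Ioo 0 1)ᶜ = 0)
    (hν0 : ν ≠ 0) {a : ℝ} (ha : 0 ≤ a) :
    ∃ u : ℝ → ℝ, Measurable u ∧ (∀ t, 0 ≤ u t) ∧ ContinuousOn u (Ioi 0) ∧ AntitoneOn u (Ioi 0) ∧
      ∀ s : ℝ, 0 < s → ∫⁻ t in Ioi 0, ENNReal.ofReal (Real.exp (-s * t)) * ENNReal.ofReal (u t)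
        = ENNReal.ofReal (a + ∫ β, s ^ β ∂ν)⁻¹ := by
  obtain ⟨ρ, hρ, hρ0, hρs⟩ := exists_stieltjes_measure hν hν0 ha
  -- `e^{-tr} ≤ 1 / (1 + tr) = t⁻¹ / (t⁻¹ + r)`, which is integrable by the Stieltjes formula at `s
  -- = t⁻¹`.
  have hint : ∀ t : ℝ, 0 < t → Integrable (fun r => Real.exp (-t * r)) ρ := by
    intro t ht
    have h1 : Integrable (fun r => t⁻¹ * (t⁻¹ + r)⁻¹) ρ := by
      refine Integrable.const_mul ⟨by fun_prop, ?_⟩ _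
      rw [hasFiniteIntegral_iff_ofReal, hρs _ (inv_pos.2 ht)]
      · exact ENNReal.ofReal_lt_top
      · filter_upwards [hρ0] with r hr
        have := inv_pos.2 ht
        simp only [Pi.zero_apply]
        positivity
    refine h1.mono' (by fun_prop) ?_
    filter_upwards [hρ0] with r hr
    rw [Real.norm_of_nonneg (Real.exp_nonneg _), neg_mul, Real.exp_neg]
    have h2 : t⁻¹ * (t⁻¹ + r)⁻¹ = (1 + t * r)⁻¹ := by
      have : 0 < t⁻¹ + r := by positivity
      field_simp
    rw [h2]
    exact inv_anti₀ (by positivity) (by linarith [Real.add_one_le_exp (t * r)])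
  have hlint : ∀ t : ℝ, 0 < t → ENNReal.ofReal (∫ r, Real.exp (-t * r) ∂ρ)
      = ∫⁻ r, ENNReal.ofReal (Real.exp (-t * r)) ∂ρ := fun t ht =>
    ofReal_integral_eq_lintegral_ofReal (hint t ht)
      (Filter.Eventually.of_forall fun _ => Real.exp_nonneg _)
  -- The Stieltjes transform is an iterated Laplace transform: `1 / (s + r) = ∫ e^{-st} e^{-rt} dt`.
  refine ⟨fun t => ∫ r, Real.exp (-t * r) ∂ρ, ?_, fun t => integral_nonneg fun _ =>
    Real.exp_nonneg _, ?_, ?_, fun s hs => ?_⟩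
  · refine StronglyMeasurable.measurable ?_
    exact StronglyMeasurable.integral_prod_right
      (f := fun t r : ℝ => Real.exp (-t * r)) (by fun_prop)
  · intro t ht
    refine ContinuousAt.continuousWithinAt ?_
    refine continuousAt_of_dominated (bound := fun r => Real.exp (-(t / 2) * r))
      (Filter.Eventually.of_forall fun _ => by fun_prop) ?_ (hint _ (half_pos ht))
      (Filter.Eventually.of_forall fun _ => by fun_prop)
    filter_upwards [lt_mem_nhds (half_lt_self (mem_Ioi.1 ht))] with x hx
    filter_upwards [hρ0] with r hr
    rw [Real.norm_of_nonneg (Real.exp_nonneg _)]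
    exact Real.exp_le_exp.2 (by nlinarith)
  · intro x hx y hy hxy
    refine integral_mono_ae (hint y hy) (hint x hx) ?_
    filter_upwards [hρ0] with r hr
    exact Real.exp_le_exp.2 (by nlinarith)
  · rw [← hρs s hs]
    calc ∫⁻ t in Ioi 0, ENNReal.ofReal (Real.exp (-s * t))
          * ENNReal.ofReal (∫ r, Real.exp (-t * r) ∂ρ)
        = ∫⁻ t in Ioi 0, ∫⁻ r, ENNReal.ofReal (Real.exp (-(s + r) * t)) ∂ρ := by
          refine setLIntegral_congr_fun measurableSet_Ioi fun t ht => ?_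
          rw [hlint t ht, ← lintegral_const_mul _ (by fun_prop)]
          refine lintegral_congr fun r => ?_
          rw [← ENNReal.ofReal_mul (Real.exp_nonneg _), ← Real.exp_add]
          congr 2; ring
      _ = ∫⁻ r, (∫⁻ t in Ioi 0, ENNReal.ofReal (Real.exp (-(s + r) * t))) ∂ρ :=
          lintegral_lintegral_swap (by fun_prop)
      _ = ∫⁻ r, ENNReal.ofReal (s + r)⁻¹ ∂ρ := by
          refine lintegral_congr_ae ?_
          filter_upwards [hρ0] with r hr
          exact lintegral_exp_neg_mul_Ioi (by linarith)

theorem integral_exp_neg_mul {s : ℝ} (hs : s ≠ 0) (y : ℝ) :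
    ∫ t in (0 : ℝ)..y, Real.exp (-s * t) = s⁻¹ * (1 - Real.exp (-s * y)) := by
  rw [intervalIntegral.integral_comp_mul_left (fun t => Real.exp t) (neg_ne_zero.2 hs),
    integral_exp]
  simp only [mul_zero, Real.exp_zero, smul_eq_mul, inv_neg]
  ring

/-- The Laplace transform of the tail of a measure on `[0, ∞)`. -/
theorem lintegral_exp_mul_tail {A : Measure ℝ} (hA : ∀ᵐ y ∂A, 0 ≤ y) {s : ℝ} (hs : 0 < s) :
    ∫⁻ t in Ioi 0, ENNReal.ofReal (Real.exp (-s * t)) * A (Ioi t)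
      = ENNReal.ofReal s⁻¹ * ∫⁻ y, ENNReal.ofReal (1 - Real.exp (-s * y)) ∂A := by
  have h := lintegral_comp_eq_lintegral_meas_lt_mul A (f := id) (g := fun t => Real.exp (-s * t))
    hA aemeasurable_id (fun t _ => Continuous.intervalIntegrable (by fun_prop) _ _)
    (Filter.Eventually.of_forall fun _ => Real.exp_nonneg _)
  simp only [id_eq, integral_exp_neg_mul hs.ne'] at h
  calc _ = ∫⁻ t in Ioi 0, A {a | t < a} * ENNReal.ofReal (Real.exp (-s * t)) := by
        refine lintegral_congr fun t => ?_
        rw [mul_comm]; rfl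
    _ = _ := by
        rw [← h, ← lintegral_const_mul _ (by fun_prop)]
        refine lintegral_congr fun y => ?_
        rw [ENNReal.ofReal_mul (inv_nonneg.2 hs.le)]

/-! ### The subordinator, its inverse and its potential measure -/

section Subordinator

variable {Ω : Type*} [MeasurableSpace Ω] {P : Measure Ω} {W : ℝ≥0 → Ω → ℝ}
  {φ : Measure ℝ}

theorem IsSubordinator.ae_nonneg (hW : IsSubordinator P W φ) : ∀ᵐ ω ∂P, ∀ x, 0 ≤ W x ω := by
  filter_upwards [hW.zero, hW.monotone] with ω h0 hm x
  exact h0 ▸ hm zero_le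

variable [IsProbabilityMeasure P]

/-- Makes the mixture defining `potential` meaningful. Paths are nondecreasing, so `x ↦ P(W_x ≤ t)`
is nonincreasing, hence Borel, and half-lines form a generating π-system. -/
theorem IsSubordinator.measurable_law (hW : IsSubordinator P W φ) :
    Measurable fun x : ℝ≥0 => P.map (W x) := by
  have : ∀ x, IsProbabilityMeasure (P.map (W x)) := fun x =>
    Measure.isProbabilityMeasure_map (hW.measurable x).aemeasurable
  refine Measurable.measure_of_isPiSystem_of_isProbabilityMeasure (borel_eq_generateFrom_Iic ℝ)
    isPiSystem_Iic ?_
  rintro _ ⟨t, rfl⟩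
  refine Antitone.measurable fun x y hxy => ?_
  rw [Measure.map_apply (hW.measurable _) measurableSet_Iic,
    Measure.map_apply (hW.measurable _) measurableSet_Iic]
  refine measure_mono_ae ?_
  filter_upwards [hW.monotone] with ω hm h using (hm hxy).trans h

theorem IsSubordinator.lintegral_exp (hW : IsSubordinator P W φ) (x : ℝ≥0) {s : ℝ} (hs : 0 < s) :
    ∫⁻ ω, ENNReal.ofReal (Real.exp (-s * W x ω)) ∂P
      = ENNReal.ofReal (Real.exp (-(x : ℝ) * ∫ y, (1 - Real.exp (-s * y)) ∂φ)) := by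
  have hm := hW.measurable x
  rw [← hW.laplace x s hs, ofReal_integral_eq_lintegral_ofReal]
  · refine Integrable.of_bound (by fun_prop) 1 ?_
    filter_upwards [hW.ae_nonneg] with ω hω
    rw [Real.norm_of_nonneg (Real.exp_nonneg _), Real.exp_le_one_iff]
    nlinarith [hω x]
  · exact Filter.Eventually.of_forall fun _ => Real.exp_nonneg _

/-- Markov's inequality gives `P(W_n ≤ t) ≤ e^t E[e^{-W_n}] = e^t e^{-nψ(1)}`, which tends to `0`.
-/
theorem IsSubordinator.ae_exists_gt (hW : IsSubordinator P W φ)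
    (hψ : 0 < ∫ y, (1 - Real.exp (-1 * y)) ∂φ) (t : ℝ) : ∀ᵐ ω ∂P, ∃ τ, t < W τ ω := by
  set ψ := ∫ y, (1 - Real.exp (-1 * y)) ∂φ with hψ'
  have hbd : ∀ n : ℕ, P {ω | ∀ τ, W τ ω ≤ t}
      ≤ ENNReal.ofReal (Real.exp t * Real.exp (-ψ) ^ n) := by
    intro n
    have hm := hW.measurable n
    have h1 := mul_meas_ge_le_lintegral (μ := P)
      (f := fun ω => ENNReal.ofReal (Real.exp (-1 * W n ω))) (by fun_prop)
      (ENNReal.ofReal (Real.exp (-t)))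
    rw [hW.lintegral_exp n one_pos, ← hψ'] at h1
    have h2 : P {ω | ∀ τ, W τ ω ≤ t} ≤ P {ω | ENNReal.ofReal (Real.exp (-t))
        ≤ ENNReal.ofReal (Real.exp (-1 * W n ω))} := by
      refine measure_mono fun ω hω => ENNReal.ofReal_le_ofReal (Real.exp_le_exp.2 ?_)
      linarith [hω n]
    calc P {ω | ∀ τ, W τ ω ≤ t}
        = ENNReal.ofReal (Real.exp t) * (ENNReal.ofReal (Real.exp (-t))
          * P {ω | ∀ τ, W τ ω ≤ t}) := by
          rw [← mul_assoc, ← ENNReal.ofReal_mul (Real.exp_nonneg _), ← Real.exp_add]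
          simp
      _ ≤ ENNReal.ofReal (Real.exp t) * ENNReal.ofReal (Real.exp (-((n : ℝ≥0) : ℝ) * ψ)) := by
          gcongr
          exact (mul_le_mul_right h2 _).trans h1
      _ = _ := by
          rw [← ENNReal.ofReal_mul (Real.exp_nonneg _), ← Real.exp_nat_mul]
          congr 3
          push_cast; ring
  have h0 : P {ω | ∀ τ, W τ ω ≤ t} = 0 := by
    refine nonpos_iff_eq_zero.1 (ge_of_tendsto' (f := fun n : ℕ => ENNReal.ofReal
      (Real.exp t * Real.exp (-ψ) ^ n)) (x := Filter.atTop) ?_ hbd)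
    have h3 := (tendsto_pow_atTop_nhds_zero_of_lt_one (Real.exp_nonneg (-ψ))
      (Real.exp_lt_one_iff.2 (neg_lt_zero.2 hψ))).const_mul (Real.exp t)
    simpa using ENNReal.tendsto_ofReal h3
  filter_upwards [measure_eq_zero_iff_ae_notMem.1 h0] with ω hω
  simpa using hω

theorem IsSubordinator.aemeasurable_inverse (hW : IsSubordinator P W φ)
    (hψ : 0 < ∫ y, (1 - Real.exp (-1 * y)) ∂φ) (t : ℝ) : AEMeasurable (inverse W t) P := by
  classical
  -- For monotone paths the infimum may be taken over rational times; the value `⊤` survives only on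
  -- the null set where level `t` is never passed.
  refine ⟨fun ω => (⨅ q : ℚ, if t < W (Real.toNNReal q) ω then ((Real.toNNReal q : ℝ≥0) : ℝ≥0∞)
    else ⊤).toReal, ?_, ?_⟩
  · refine ENNReal.measurable_toReal.comp (Measurable.iInf fun q => ?_)
    exact Measurable.ite (measurableSet_lt measurable_const (hW.measurable _)) measurable_const
      measurable_const
  · filter_upwards [hW.monotone, hW.ae_exists_gt hψ t] with ω hm hne
    rw [inverse, ← ENNReal.coe_toReal]
    congr 1
    refine le_antisymm (le_iInf fun q => ?_) (le_of_forall_gt fun c hc => ?_)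
    · split_ifs with hq
      · exact ENNReal.coe_le_coe.2 (csInf_le (OrderBot.bddBelow _) hq)
      · exact le_top
    · obtain ⟨b, hb1, hb2⟩ := ENNReal.lt_iff_exists_nnreal_btwn.1 hc
      obtain ⟨τ, hτ, hτb⟩ := exists_lt_of_csInf_lt hne (ENNReal.coe_lt_coe.1 hb1)
      obtain ⟨q, -, hq1, hq2⟩ := ENNReal.lt_iff_exists_rat_btwn.1 (ENNReal.coe_lt_coe.2 hτb)
      refine (iInf_le _ q).trans_lt ?_
      rw [if_pos (lt_of_lt_of_le (mem_ofPred.1 hτ) (hm (ENNReal.coe_lt_coe.1 hq1).le))]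
      exact hq2.trans hb2

/-- The `l`-potential measure `∫_0^∞ e^{-lx} P_{W(x)} dx`. -/
noncomputable def potential (P : Measure Ω) (W : ℝ≥0 → Ω → ℝ) (l : ℝ) : Measure ℝ :=
  ((volume.restrict (Ioi 0)).withDensity fun x => ENNReal.ofReal (Real.exp (-l * x))).bind
    fun x => P.map (W x.toNNReal)

theorem IsSubordinator.lintegral_potential (hW : IsSubordinator P W φ) (l : ℝ) {f : ℝ → ℝ≥0∞}
    (hf : Measurable f) : ∫⁻ y, f y ∂(potential P W l)
      = ∫⁻ x in Ioi (0 : ℝ), ENNReal.ofReal (Real.exp (-l * x))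
        * ∫⁻ y, f y ∂(P.map (W x.toNNReal)) := by
  have hm : Measurable fun x : ℝ => P.map (W x.toNNReal) :=
    hW.measurable_law.comp measurable_real_toNNReal
  rw [potential, Measure.lintegral_bind hm.aemeasurable hf.aemeasurable,
    lintegral_withDensity_eq_lintegral_mul _ (by fun_prop)
      (show Measurable fun x : ℝ => ∫⁻ y, f y ∂(P.map (W x.toNNReal)) from
        (Measure.measurable_lintegral hf).comp hm)]
  rfl

theorem IsSubordinator.potential_apply (hW : IsSubordinator P W φ) (l : ℝ) {A : Set ℝ}
    (hA : MeasurableSet A) : potential P W l A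
      = ∫⁻ x in Ioi (0 : ℝ), ENNReal.ofReal (Real.exp (-l * x)) * P (W x.toNNReal ⁻¹' A) := by
  rw [← lintegral_indicator_one hA, hW.lintegral_potential l (measurable_one.indicator hA)]
  refine lintegral_congr fun x => ?_
  rw [lintegral_indicator_one hA, Measure.map_apply (hW.measurable _) hA]

theorem IsSubordinator.potential_univ (hW : IsSubordinator P W φ) {l : ℝ} (hl : 0 < l) :
    potential P W l univ = ENNReal.ofReal l⁻¹ := by
  rw [hW.potential_apply l MeasurableSet.univ, ← lintegral_exp_neg_mul_Ioi hl]
  simp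

theorem IsSubordinator.ae_potential_nonneg (hW : IsSubordinator P W φ) (l : ℝ) :
    ∀ᵐ y ∂(potential P W l), 0 ≤ y := by
  have h : potential P W l (Iio 0) = 0 := by
    rw [hW.potential_apply l measurableSet_Iio]
    have : ∀ x : ℝ, P (W x.toNNReal ⁻¹' Iio 0) = 0 := fun x => by
      refine measure_eq_zero_iff_ae_notMem.2 ?_
      filter_upwards [hW.ae_nonneg] with ω hω
      simpa using hω _
    simp [this]
  filter_upwards [measure_eq_zero_iff_ae_notMem.1 h] with y hy
  simpa using hy

theorem IsSubordinator.laplace_potential (hW : IsSubordinator P W φ) {l : ℝ} {s : ℝ} (hs : 0 < s)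
    (hψ : 0 < l + ∫ y, (1 - Real.exp (-s * y)) ∂φ) :
    ∫⁻ y, ENNReal.ofReal (Real.exp (-s * y)) ∂(potential P W l)
      = ENNReal.ofReal (l + ∫ y, (1 - Real.exp (-s * y)) ∂φ)⁻¹ := by
  rw [hW.lintegral_potential l (by fun_prop), ← lintegral_exp_neg_mul_Ioi hψ]
  refine setLIntegral_congr_fun measurableSet_Ioi fun x hx => ?_
  rw [lintegral_map (by fun_prop) (hW.measurable _), hW.lintegral_exp _ hs,
    ← ENNReal.ofReal_mul (Real.exp_nonneg _), ← Real.exp_add, Real.coe_toNNReal _ (le_of_lt hx)]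
  congr 2; ring

theorem IsSubordinator.integrable_exp_inverse (hW : IsSubordinator P W φ)
    (hψ : 0 < ∫ y, (1 - Real.exp (-1 * y)) ∂φ) {l : ℝ} (hl : 0 < l) (t : ℝ) :
    Integrable (fun ω => Real.exp (-l * inverse W t ω)) P := by
  have hE := hW.aemeasurable_inverse hψ t
  refine Integrable.of_bound (by fun_prop) 1 (Filter.Eventually.of_forall fun ω => ?_)
  rw [Real.norm_of_nonneg (Real.exp_nonneg _), Real.exp_le_one_iff]
  have : 0 ≤ inverse W t ω := NNReal.coe_nonneg _
  nlinarith

/-- Write `1 - e^{-lE} = ∫_0^E l e^{-lx} dx` and apply the layer-cake formula. The strict and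
non-strict versions have the same value, so the inclusions `{E_t > x} ⊆ {W_x ≤ t} ⊆ {E_t ≥ x}`
squeeze it, without recourse to right continuity. -/
theorem IsSubordinator.one_sub_h (hW : IsSubordinator P W φ)
    (hψ : 0 < ∫ y, (1 - Real.exp (-1 * y)) ∂φ) {l : ℝ} (hl : 0 < l) (t : ℝ) :
    ENNReal.ofReal (1 - h P W t l) = ENNReal.ofReal l * potential P W l (Iic t) := by
  have hE := hW.aemeasurable_inverse hψ t
  have hE0 : ∀ ω, 0 ≤ inverse W t ω := fun ω => NNReal.coe_nonneg _
  have hI := hW.integrable_exp_inverse hψ hl t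
  have hprim : ∀ y : ℝ, ∫ x in (0 : ℝ)..y, l * Real.exp (-l * x) = 1 - Real.exp (-l * y) := by
    intro y
    rw [intervalIntegral.integral_const_mul, integral_exp_neg_mul hl.ne',
      mul_inv_cancel_left₀ hl.ne']
  have hleft : ENNReal.ofReal (1 - h P W t l)
      = ∫⁻ ω, ENNReal.ofReal (∫ x in (0 : ℝ)..inverse W t ω, l * Real.exp (-l * x)) ∂P := by
    simp only [hprim]
    have hI1 : Integrable (fun ω => 1 - Real.exp (-l * inverse W t ω)) P :=
      (integrable_const 1).sub hI
    rw [← ofReal_integral_eq_lintegral_ofReal hI1]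
    · rw [integral_sub (integrable_const 1) hI]; simp [h]
    · refine Filter.Eventually.of_forall fun ω => ?_
      simp only [Pi.zero_apply, sub_nonneg, Real.exp_le_one_iff]
      nlinarith [hE0 ω]
  have hnn : ∀ x : ℝ, 0 ≤ l * Real.exp (-l * x) := fun x => by positivity
  have hright : ENNReal.ofReal l * potential P W l (Iic t) = ∫⁻ x in Ioi (0 : ℝ),
      P {ω | W x.toNNReal ω ≤ t} * ENNReal.ofReal (l * Real.exp (-l * x)) := by
    rw [hW.potential_apply l measurableSet_Iic, ← lintegral_const_mul' _ _ ENNReal.ofReal_ne_top]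
    refine lintegral_congr fun x => ?_
    rw [ENNReal.ofReal_mul hl.le, ← mul_assoc, mul_comm]
    rfl
  rw [hleft, hright]
  refine le_antisymm ?_ ?_
  · rw [lintegral_comp_eq_lintegral_meas_lt_mul P (Filter.Eventually.of_forall hE0) hE
      (fun t _ => Continuous.intervalIntegrable (by fun_prop) _ _)
      (Filter.Eventually.of_forall hnn)]
    refine setLIntegral_mono' measurableSet_Ioi fun x hx => ?_
    gcongr ?_ * _
    refine measure_mono fun ω (hω : x < inverse W t ω) => ?_
    by_contra hlt
    have hgt : t < W x.toNNReal ω := not_le.1 hlt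
    have h1 : sInf {τ : ℝ≥0 | t < W τ ω} ≤ x.toNNReal :=
      csInf_le (OrderBot.bddBelow _) hgt
    have h2 : inverse W t ω ≤ x := by
      rw [inverse, ← Real.coe_toNNReal x (le_of_lt hx)]
      exact_mod_cast h1
    linarith
  · rw [lintegral_comp_eq_lintegral_meas_le_mul P (Filter.Eventually.of_forall hE0) hE
      (fun t _ => Continuous.intervalIntegrable (by fun_prop) _ _)
      (Filter.Eventually.of_forall hnn)]
    refine setLIntegral_mono' measurableSet_Ioi fun x hx => ?_
    gcongr ?_ * _
    refine measure_mono_ae ?_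
    filter_upwards [hW.monotone, hW.ae_exists_gt hψ t] with ω hm hne hω
    change x ≤ inverse W t ω
    rw [inverse, ← Real.coe_toNNReal x (le_of_lt hx)]
    refine NNReal.coe_le_coe.2 (le_csInf hne fun τ hτ => ?_)
    by_contra hlt
    exact absurd ((hm (not_le.1 hlt).le).trans hω) (not_le.2 hτ)

end Subordinator

/-! ### The Laplace exponent as an integral of powers -/

theorem lintegral_exp_mul_rpow {s : ℝ} (hs : 0 < s) {β : ℝ} (hβ : β < 1) :
    ∫⁻ t in Ioi (0 : ℝ), ENNReal.ofReal (Real.exp (-s * t)) * ENNReal.ofReal (t ^ (-β))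
      = ENNReal.ofReal s⁻¹ * (ENNReal.ofReal (Real.Gamma (1 - β)) * ENNReal.ofReal (s ^ β)) := by
  have hG : 0 < Real.Gamma (1 - β) := Real.Gamma_pos_of_pos (by linarith)
  have h1 := Real.integral_rpow_mul_exp_neg_mul_Ioi (a := 1 - β) (r := s) (by linarith) hs
  -- A non-integrable function has Bochner integral `0`, so a nonzero value proves integrability.
  have hne : ∫ t in Ioi (0 : ℝ), t ^ (1 - β - 1) * Real.exp (-(s * t)) ≠ 0 := by
    rw [h1]
    exact (mul_pos (Real.rpow_pos_of_pos (by positivity) _) hG).ne'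
  have hint : IntegrableOn (fun t : ℝ => t ^ (1 - β - 1) * Real.exp (-(s * t))) (Ioi 0) :=
    not_imp_comm.1 integral_undef hne
  have hval : (1 / s) ^ (1 - β) * Real.Gamma (1 - β) = s⁻¹ * (Real.Gamma (1 - β) * s ^ β) := by
    rw [one_div, Real.inv_rpow hs.le, Real.rpow_sub hs, Real.rpow_one, inv_div]
    ring
  rw [← ENNReal.ofReal_mul hG.le, ← ENNReal.ofReal_mul (inv_nonneg.2 hs.le), ← hval, ← h1,
    ofReal_integral_eq_lintegral_ofReal hint]
  · refine setLIntegral_congr_fun measurableSet_Ioi fun t _ => ?_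
    rw [← ENNReal.ofReal_mul (Real.exp_nonneg _), mul_comm, sub_sub_cancel_left, neg_mul]
  · filter_upwards [self_mem_ae_restrict measurableSet_Ioi] with t ht
    exact mul_nonneg (Real.rpow_nonneg (le_of_lt ht) _) (Real.exp_nonneg _)

section LevyMeasure

variable {μ φ : Measure ℝ}

/-- `1 / Γ` is entire, hence measurable, and inverting it avoids any discussion of poles. -/
theorem measurable_gamma_one_sub : Measurable fun β : ℝ => Real.Gamma (1 - β) := by
  have h : Measurable Real.Gamma := by
    have h1 : Measurable fun z : ℂ => (Complex.Gamma z)⁻¹ :=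
      Complex.differentiable_one_div_Gamma.continuous.measurable
    have h2 : Real.Gamma = fun x : ℝ => ((Complex.Gamma x)⁻¹)⁻¹.re := by
      funext x
      rw [inv_inv]
      rfl
    rw [h2]
    exact Complex.measurable_re.comp ((h1.comp Complex.measurable_ofReal).inv)
  exact h.comp (by fun_prop)

theorem orderMeasure_compl (hμ : μ (Ioo 0 1)ᶜ = 0) : orderMeasure μ (Ioo 0 1)ᶜ = 0 :=
  withDensity_absolutelyContinuous _ _ hμ

variable [IsProbabilityMeasure μ]

/-- The Laplace transform of the tail is computed twice: layer cake gives `s⁻¹ ψ(s)`, while Tonelli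
over `β` and `∫ e^{-st} t^{-β} dt = Γ(1 - β) s^{β - 1}` give the other side. -/
theorem lintegral_one_sub_exp_levy (hμ : μ (Ioo 0 1)ᶜ = 0)
    (hφ : ∀ t : ℝ, 0 < t → φ (Ioi t) = ∫⁻ β, ENNReal.ofReal (t ^ (-β)) ∂μ)
    (hφ0 : φ (Iic 0) = 0) {s : ℝ} (hs : 0 < s) :
    ∫⁻ y, ENNReal.ofReal (1 - Real.exp (-s * y)) ∂φ
      = ∫⁻ β, ENNReal.ofReal (s ^ β) ∂(orderMeasure μ) := by
  have hpos : ∀ᵐ y ∂φ, 0 ≤ y := by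
    filter_upwards [measure_eq_zero_iff_ae_notMem.1 hφ0] with y hy
    exact (not_le.1 hy).le
  have h1 := lintegral_exp_mul_tail hpos hs
  have h2 : ∫⁻ t in Ioi 0, ENNReal.ofReal (Real.exp (-s * t)) * φ (Ioi t)
      = ENNReal.ofReal s⁻¹ * ∫⁻ β, ENNReal.ofReal (s ^ β) ∂(orderMeasure μ) := by
    calc ∫⁻ t in Ioi 0, ENNReal.ofReal (Real.exp (-s * t)) * φ (Ioi t)
        = ∫⁻ t in Ioi 0, ∫⁻ β, ENNReal.ofReal (Real.exp (-s * t))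
            * ENNReal.ofReal (t ^ (-β)) ∂μ := by
          refine setLIntegral_congr_fun measurableSet_Ioi fun t ht => ?_
          rw [hφ t ht, lintegral_const_mul _ (by fun_prop)]
      _ = ∫⁻ β, (∫⁻ t in Ioi 0, ENNReal.ofReal (Real.exp (-s * t))
            * ENNReal.ofReal (t ^ (-β))) ∂μ :=
          lintegral_lintegral_swap (by fun_prop)
      _ = ∫⁻ β, ENNReal.ofReal s⁻¹ * (ENNReal.ofReal (Real.Gamma (1 - β))
            * ENNReal.ofReal (s ^ β)) ∂μ := by
          refine lintegral_congr_ae ?_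
          filter_upwards [ae_mem_Ioo hμ] with β hβ using lintegral_exp_mul_rpow hs hβ.2
      _ = _ := by
          have hm := measurable_gamma_one_sub.ennreal_ofReal
          rw [lintegral_const_mul' _ _ ENNReal.ofReal_ne_top, orderMeasure,
            lintegral_withDensity_eq_lintegral_mul _ hm (by fun_prop)]
          rfl
  rw [h2] at h1
  exact ((ENNReal.mul_right_inj (by simpa using hs) ENNReal.ofReal_ne_top).1 h1).symm

/-- At `s = 1` the total mass of `ν` equals `ψ(1)`, and `1 - e^{-y} ≤ min 1 y`. -/
theorem isFiniteMeasure_orderMeasure (hμ : μ (Ioo 0 1)ᶜ = 0)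
    (hφ : ∀ t : ℝ, 0 < t → φ (Ioi t) = ∫⁻ β, ENNReal.ofReal (t ^ (-β)) ∂μ)
    (hφ0 : φ (Iic 0) = 0) (hφ1 : ∫⁻ x, ENNReal.ofReal (min 1 x) ∂φ < ∞) :
    IsFiniteMeasure (orderMeasure μ) := by
  have h := lintegral_one_sub_exp_levy hμ hφ hφ0 one_pos
  simp only [Real.one_rpow, ENNReal.ofReal_one, lintegral_one] at h
  refine ⟨h ▸ lt_of_le_of_lt (lintegral_mono fun y => ENNReal.ofReal_le_ofReal ?_) hφ1⟩
  refine le_min ?_ ?_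
  · linarith [Real.exp_pos (-1 * y)]
  · linarith [Real.add_one_le_exp (-1 * y)]

theorem orderMeasure_ne_zero (hμ : μ (Ioo 0 1)ᶜ = 0) : orderMeasure μ ≠ 0 := by
  intro h
  rw [orderMeasure, withDensity_eq_zero_iff
    measurable_gamma_one_sub.ennreal_ofReal.aemeasurable] at h
  have hF : ∀ᵐ β ∂μ, False := by
    filter_upwards [h, ae_mem_Ioo hμ] with β h1 h2
    have : 0 < Real.Gamma (1 - β) := Real.Gamma_pos_of_pos (by linarith [h2.2])
    simp only [Pi.zero_apply, ENNReal.ofReal_eq_zero] at h1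
    linarith
  exact IsProbabilityMeasure.ne_zero μ (by simpa using hF)

theorem integral_one_sub_exp_levy (hμ : μ (Ioo 0 1)ᶜ = 0)
    (hφ : ∀ t : ℝ, 0 < t → φ (Ioi t) = ∫⁻ β, ENNReal.ofReal (t ^ (-β)) ∂μ)
    (hφ0 : φ (Iic 0) = 0) {s : ℝ} (hs : 0 < s) :
    ∫ y, (1 - Real.exp (-s * y)) ∂φ = ∫ β, s ^ β ∂(orderMeasure μ) := by
  rw [integral_eq_lintegral_of_nonneg_ae, integral_eq_lintegral_of_nonneg_ae,
    lintegral_one_sub_exp_levy hμ hφ hφ0 hs]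
  · exact Filter.Eventually.of_forall fun β => Real.rpow_nonneg hs.le β
  · fun_prop
  · filter_upwards [measure_eq_zero_iff_ae_notMem.1 hφ0] with y hy
    have hy' : 0 < y := not_le.1 hy
    simp only [Pi.zero_apply, sub_nonneg, Real.exp_le_one_iff]
    nlinarith
  · fun_prop

theorem integral_rpow_orderMeasure_pos (hμ : μ (Ioo 0 1)ᶜ = 0) [IsFiniteMeasure (orderMeasure μ)]
    {s : ℝ} (hs : 0 < s) : 0 < ∫ β, s ^ β ∂(orderMeasure μ) :=
  integral_pos_of_pos_on_Ioo (orderMeasure_compl hμ) (orderMeasure_ne_zero hμ)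
    (Real.continuous_const_rpow hs.ne') fun β _ => Real.rpow_pos_of_pos hs β

end LevyMeasure

/-! ### Convolutions on the half-line -/

/-- The Laplace transform turns convolution on `(0, ∞)` into multiplication. -/
theorem laplace_convolution {T v : ℝ → ℝ≥0∞} (hT : Measurable T) (hv : Measurable v) (s : ℝ) :
    ∫⁻ t in Ioi 0, ENNReal.ofReal (Real.exp (-s * t)) * ∫⁻ y in Ioo 0 t, T (t - y) * v y
      = (∫⁻ t in Ioi 0, ENNReal.ofReal (Real.exp (-s * t)) * T t)
        * ∫⁻ y in Ioi 0, ENNReal.ofReal (Real.exp (-s * y)) * v y := by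
  set e : ℝ → ℝ≥0∞ := fun t => ENNReal.ofReal (Real.exp (-s * t)) with he
  have hem : Measurable e := by fun_prop
  have hadd : ∀ t y, e t = e (t - y) * e y := by
    intro t y
    simp only [he]
    rw [← ENNReal.ofReal_mul (Real.exp_nonneg _), ← Real.exp_add]
    congr 2; ring
  -- Extending by zero and splitting `e^{-st} = e^{-s(t-y)} e^{-sy}` gives a convolution on the
  -- whole line, where translation invariance applies.
  set T' : ℝ → ℝ≥0∞ := (Ioi 0).indicator fun t => e t * T t with hT'
  set v' : ℝ → ℝ≥0∞ := (Ioi 0).indicator fun t => e t * v t with hv'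
  have hTm : Measurable T' := (hem.mul hT).indicator measurableSet_Ioi
  have hvm : Measurable v' := (hem.mul hv).indicator measurableSet_Ioi
  have hinner : ∀ t : ℝ, (Ioi 0).indicator (fun t => e t * ∫⁻ y in Ioo 0 t, T (t - y) * v y) t
      = ∫⁻ y, T' (t - y) * v' y := by
    intro t
    have h1 : ∀ y, T' (t - y) * v' y
        = (Ioo 0 t).indicator (fun y => e t * (T (t - y) * v y)) y := by
      intro y
      by_cases hy : y ∈ Ioo 0 t
      · rw [indicator_of_mem hy, hT', hv', indicator_of_mem (mem_Ioi.2 (sub_pos.2 hy.2)),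
          indicator_of_mem (mem_Ioi.2 hy.1), hadd t y]
        ring
      · rw [indicator_of_notMem hy]
        by_cases hy0 : 0 < y
        · have : t - y ∉ Ioi (0 : ℝ) := fun h => hy ⟨hy0, sub_pos.1 h⟩
          rw [hT', indicator_of_notMem this, zero_mul]
        · rw [hv', indicator_of_notMem (by simpa using hy0), mul_zero]
    simp only [h1]
    rw [lintegral_indicator measurableSet_Ioo]
    by_cases ht : t ∈ Ioi (0 : ℝ)
    · rw [indicator_of_mem ht, lintegral_const_mul _ (by fun_prop)]
    · rw [indicator_of_notMem ht, Ioo_eq_empty (by simpa using ht)]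
      simp
  rw [← lintegral_indicator measurableSet_Ioi (fun t => e t * ∫⁻ y in Ioo 0 t, T (t - y) * v y)]
  simp only [hinner]
  rw [lintegral_lintegral_swap (by fun_prop)]
  have h2 : ∀ y, ∫⁻ t, T' (t - y) * v' y = (∫⁻ t, T' t) * v' y := by
    intro y
    rw [lintegral_mul_const _ (by fun_prop), lintegral_sub_right_eq_self]
  simp only [h2]
  rw [lintegral_const_mul _ hvm, hT', hv', lintegral_indicator measurableSet_Ioi,
    lintegral_indicator measurableSet_Ioi]

theorem measurable_convolution {T v : ℝ → ℝ≥0∞} (hT : Measurable T) (hv : Measurable v) :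
    Measurable fun t : ℝ => ∫⁻ y in Ioo 0 t, T (t - y) * v y := by
  have h : ∀ t : ℝ, ∫⁻ y in Ioo 0 t, T (t - y) * v y
      = ∫⁻ y, {p : ℝ × ℝ | 0 < p.2 ∧ p.2 < p.1}.indicator
        (fun p => T (p.1 - p.2) * v p.2) (t, y) := by
    intro t
    rw [← lintegral_indicator measurableSet_Ioo]
    rfl
  simp only [h]
  refine Measurable.lintegral_prod_right' (f := {p : ℝ × ℝ | 0 < p.2 ∧ p.2 < p.1}.indicator
        (fun p => T (p.1 - p.2) * v p.2)) (Measurable.indicator (by fun_prop) ?_)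
  exact (measurableSet_lt measurable_const measurable_snd).inter
    (measurableSet_lt measurable_snd measurable_fst)

/-- On a fixed interval the endpoint singularities no longer move with `t`, so dominated convergence
becomes available. -/
theorem convolution_eq_rescaled (T v : ℝ → ℝ≥0∞) {t : ℝ} (ht : 0 < t) :
    ∫⁻ y in Ioo 0 t, T (t - y) * v y
      = ∫⁻ θ in Ioo (0 : ℝ) 1, ENNReal.ofReal t * (T (t * (1 - θ)) * v (t * θ)) := by
  have himg : (fun θ => t * θ) '' Ioo (0 : ℝ) 1 = Ioo 0 t := by
    rw [image_mul_left_Ioo ht]; simp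
  rw [← himg, lintegral_image_eq_lintegral_abs_deriv_mul measurableSet_Ioo
    (f' := fun _ => t) (fun x _ => by
      simpa using ((hasDerivAt_id x).const_mul t).hasDerivWithinAt)
    (fun x _ y _ hxy => mul_left_cancel₀ ht.ne' hxy)]
  refine lintegral_congr fun θ => ?_
  rw [abs_of_pos ht, mul_one_sub]

/-- The convolution of nonincreasing functions that are continuous on `(0, ∞)` is continuous there
as soon as it is finite almost everywhere. -/
theorem continuousOn_convolution {T v : ℝ → ℝ≥0∞} (hT : Measurable T) (hv : Measurable v)
    (hTa : AntitoneOn T (Ioi 0)) (hva : AntitoneOn v (Ioi 0))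
    (hTc : ContinuousOn T (Ioi 0)) (hvc : ContinuousOn v (Ioi 0))
    (hTf : ∀ t, 0 < t → T t ≠ ∞) (hvf : ∀ t, 0 < t → v t ≠ ∞)
    (hfin : ∀ᵐ t ∂(volume.restrict (Ioi (0 : ℝ))), ∫⁻ y in Ioo 0 t, T (t - y) * v y ≠ ∞) :
    ContinuousOn (fun t : ℝ => ∫⁻ y in Ioo 0 t, T (t - y) * v y) (Ioi 0) := by
  intro t₀ ht₀
  have ht₀' : 0 < t₀ := ht₀
  -- A finite value at one point `a < t₀` supplies the dominating function: for `t > a` monotonicity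
  -- bounds both rescaled factors by those at `a`, and `2 * t₀` bounds the prefactor.
  obtain ⟨a, ⟨ha0, hat⟩, ha⟩ : ∃ a ∈ Ioo 0 t₀, ∫⁻ y in Ioo 0 a, T (a - y) * v y ≠ ∞ := by
    have hne : (ae (volume.restrict (Ioo 0 t₀))).NeBot := by
      rw [ae_neBot, ne_eq, Measure.restrict_eq_zero]
      simpa using ht₀'
    have h1 : ∀ᵐ a ∂(volume.restrict (Ioo 0 t₀)), ∫⁻ y in Ioo 0 a, T (a - y) * v y ≠ ∞ :=
      ae_mono (Measure.restrict_mono Ioo_subset_Ioi_self le_rfl) hfin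
    have h0 : ∀ᵐ a ∂(volume.restrict (Ioo 0 t₀)), a ∈ Ioo 0 t₀ :=
      self_mem_ae_restrict measurableSet_Ioo
    obtain ⟨a, ha1, ha2⟩ := (h0.and h1).exists
    exact ⟨a, ha1, ha2⟩
  refine ContinuousAt.continuousWithinAt ?_
  have heq : (fun t : ℝ => ∫⁻ y in Ioo 0 t, T (t - y) * v y) =ᶠ[nhds t₀] fun t =>
      ∫⁻ θ in Ioo (0 : ℝ) 1, ENNReal.ofReal t * (T (t * (1 - θ)) * v (t * θ)) := by
    filter_upwards [lt_mem_nhds ht₀'] with t ht using convolution_eq_rescaled T v ht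
  refine ContinuousAt.congr ?_ heq.symm
  refine tendsto_lintegral_filter_of_dominated_convergence
    (fun θ => ENNReal.ofReal (2 * t₀) * (T (a * (1 - θ)) * v (a * θ)))
    (Filter.Eventually.of_forall fun t => by fun_prop) ?_ ?_ ?_
  · filter_upwards [lt_mem_nhds hat, gt_mem_nhds (show t₀ < 2 * t₀ by linarith)] with t h1 h2
    filter_upwards [self_mem_ae_restrict measurableSet_Ioo] with θ hθ
    have hθ1 : 0 < 1 - θ := sub_pos.2 hθ.2
    have ht : 0 < t := ha0.trans h1
    refine mul_le_mul' (ENNReal.ofReal_le_ofReal h2.le) (mul_le_mul' ?_ ?_)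
    · exact hTa (mul_pos ha0 hθ1) (mul_pos ht hθ1) (by gcongr)
    · exact hva (mul_pos ha0 hθ.1) (mul_pos ht hθ.1) (mul_le_mul_of_nonneg_right h1.le hθ.1.le)
  · rw [convolution_eq_rescaled T v ha0, lintegral_const_mul _ (by fun_prop)] at ha
    rw [lintegral_const_mul _ (by fun_prop)]
    refine ENNReal.mul_ne_top ENNReal.ofReal_ne_top fun htop => ha ?_
    rw [htop, ENNReal.mul_top (by simpa using ha0)]
  · filter_upwards [self_mem_ae_restrict measurableSet_Ioo] with θ hθ
    have hp1 : 0 < t₀ * (1 - θ) := mul_pos ht₀' (sub_pos.2 hθ.2)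
    have hp2 : 0 < t₀ * θ := mul_pos ht₀' hθ.1
    have c1 : Filter.Tendsto (fun t => T (t * (1 - θ))) (nhds t₀) (nhds (T (t₀ * (1 - θ)))) :=
      ContinuousAt.comp (f := fun t : ℝ => t * (1 - θ)) (hTc.continuousAt (Ioi_mem_nhds hp1))
        (by fun_prop)
    have c2 : Filter.Tendsto (fun t => v (t * θ)) (nhds t₀) (nhds (v (t₀ * θ))) :=
      ContinuousAt.comp (f := fun t : ℝ => t * θ) (hvc.continuousAt (Ioi_mem_nhds hp2))
        (by fun_prop)
    have c3 : Filter.Tendsto (fun t => ENNReal.ofReal t) (nhds t₀) (nhds (ENNReal.ofReal t₀)) :=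
      ENNReal.continuous_ofReal.continuousAt
    exact ENNReal.Tendsto.mul c3 (Or.inr (ENNReal.mul_ne_top (hTf _ hp1) (hvf _ hp2)))
      (ENNReal.Tendsto.mul c1 (Or.inr (hvf _ hp2)) c2 (Or.inr (hTf _ hp1)))
      (Or.inr ENNReal.ofReal_ne_top)

/-! ### Regularity of the Lévy tail -/

section Tail

variable {μ φ : Measure ℝ} [IsProbabilityMeasure μ]

theorem levy_tail_ne_top (hμ : μ (Ioo 0 1)ᶜ = 0)
    (hφ : ∀ t : ℝ, 0 < t → φ (Ioi t) = ∫⁻ β, ENNReal.ofReal (t ^ (-β)) ∂μ) {t : ℝ} (ht : 0 < t) :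
    φ (Ioi t) ≠ ∞ := by
  have hint : Integrable (fun β : ℝ => t ^ (-β)) μ :=
    integrable_of_continuous hμ ((Real.continuous_const_rpow ht.ne').comp continuous_neg)
  rw [hφ t ht, ← ofReal_integral_eq_lintegral_ofReal hint
    (Filter.Eventually.of_forall fun β => Real.rpow_nonneg ht.le _)]
  exact ENNReal.ofReal_ne_top

theorem continuousOn_levy_tail (hμ : μ (Ioo 0 1)ᶜ = 0)
    (hφ : ∀ t : ℝ, 0 < t → φ (Ioi t) = ∫⁻ β, ENNReal.ofReal (t ^ (-β)) ∂μ) :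
    ContinuousOn (fun t => φ (Ioi t)) (Ioi 0) := by
  refine ContinuousOn.congr (f := fun t : ℝ => ∫⁻ β, ENNReal.ofReal (t ^ (-β)) ∂μ) ?_
    fun t ht => hφ t ht
  intro t₀ ht₀
  have ht₀' : 0 < t₀ := ht₀
  refine ContinuousAt.continuousWithinAt ?_
  refine tendsto_lintegral_filter_of_dominated_convergence
    (fun β => ENNReal.ofReal ((t₀ / 2) ^ (-β)))
    (Filter.Eventually.of_forall fun t => by fun_prop) ?_ ?_ ?_
  · filter_upwards [lt_mem_nhds (half_lt_self ht₀')] with t ht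
    filter_upwards [ae_mem_Ioo hμ] with β hβ
    exact ENNReal.ofReal_le_ofReal
      (Real.rpow_le_rpow_of_nonpos (half_pos ht₀') ht.le (by linarith [hβ.1]))
  · rw [← hφ _ (half_pos ht₀')]
    exact levy_tail_ne_top hμ hφ (half_pos ht₀')
  · exact Filter.Eventually.of_forall fun β =>
      (ENNReal.continuous_ofReal.continuousAt.comp
        (Real.continuousAt_rpow_const t₀ (-β) (Or.inl ht₀'.ne')))

theorem measurable_levy_tail : Measurable fun t => φ (Ioi t) :=
  Antitone.measurable fun _ _ hxy => measure_mono (Ioi_subset_Ioi hxy)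

theorem levy_exponent_one_pos {Ω : Type*} [MeasurableSpace Ω] {P : Measure Ω} {W : ℝ≥0 → Ω → ℝ}
    (hμ : μ (Ioo 0 1)ᶜ = 0)
    (hφ : ∀ t : ℝ, 0 < t → φ (Ioi t) = ∫⁻ β, ENNReal.ofReal (t ^ (-β)) ∂μ)
    (hW : IsSubordinator P W φ) : 0 < ∫ y, (1 - Real.exp (-1 * y)) ∂φ := by
  have := isFiniteMeasure_orderMeasure hμ hφ hW.levy_support hW.levy_integrable
  rw [integral_one_sub_exp_levy hμ hφ hW.levy_support one_pos]
  exact integral_rpow_orderMeasure_pos hμ one_pos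

end Tail

/-! ### The potential density and the Laplace transform of `h` -/

section Inverse

variable {Ω : Type*} [MeasurableSpace Ω] {P : Measure Ω} [IsProbabilityMeasure P]
  {μ φ : Measure ℝ} [IsProbabilityMeasure μ] {W : ℝ≥0 → Ω → ℝ} {l : ℝ}

theorem exists_potential_density (hμ : μ (Ioo 0 1)ᶜ = 0)
    (hφ : ∀ t : ℝ, 0 < t → φ (Ioi t) = ∫⁻ β, ENNReal.ofReal (t ^ (-β)) ∂μ)
    (hW : IsSubordinator P W φ) (hl : 0 < l) :
    ∃ u : ℝ → ℝ, Measurable u ∧ (∀ t, 0 ≤ u t) ∧ ContinuousOn u (Ioi 0) ∧ AntitoneOn u (Ioi 0) ∧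
      potential P W l = (volume.restrict (Ioi 0)).withDensity fun t => ENNReal.ofReal (u t) := by
  have := isFiniteMeasure_orderMeasure hμ hφ hW.levy_support hW.levy_integrable
  obtain ⟨u, hum, hu0, huc, hua, hus⟩ := exists_resolvent_density (orderMeasure_compl hμ)
    (orderMeasure_ne_zero hμ) hl.le
  refine ⟨u, hum, hu0, huc, hua, ?_⟩
  have hlap : ∀ s : ℝ, 0 < s → ∫⁻ y, ENNReal.ofReal (Real.exp (-s * y)) ∂(potential P W l)
      = ENNReal.ofReal (l + ∫ β, s ^ β ∂(orderMeasure μ))⁻¹ := by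
    intro s hs
    have hψ := integral_one_sub_exp_levy hμ hφ hW.levy_support hs
    have hpos := integral_rpow_orderMeasure_pos hμ hs
    rw [hW.laplace_potential hs (by rw [hψ]; linarith), hψ]
  refine measure_ext_of_laplace (fun s hs => ?_) fun s hs => ?_
  · rw [hlap s hs]; exact ENNReal.ofReal_ne_top
  · rw [hlap s hs, ← hus s hs, lintegral_withDensity_eq_lintegral_mul _ (by fun_prop)
      (by fun_prop)]
    refine lintegral_congr fun t => ?_
    rw [mul_comm]; rfl

theorem h_nonneg (P : Measure Ω) (W : ℝ≥0 → Ω → ℝ) (t l : ℝ) : 0 ≤ h P W t l :=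
  integral_nonneg fun _ => Real.exp_nonneg _

theorem h_le_one (hl : 0 < l) (t : ℝ) : h P W t l ≤ 1 := by
  have hb : ∀ ω, Real.exp (-l * inverse W t ω) ≤ 1 := fun ω => by
    rw [Real.exp_le_one_iff]
    have : 0 ≤ inverse W t ω := NNReal.coe_nonneg _
    nlinarith
  have := integral_mono_of_nonneg (μ := P) (Filter.Eventually.of_forall fun _ => Real.exp_nonneg _)
    (integrable_const (1 : ℝ)) (Filter.Eventually.of_forall hb)
  simpa [h] using this

theorem ofReal_h (hμ : μ (Ioo 0 1)ᶜ = 0)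
    (hφ : ∀ t : ℝ, 0 < t → φ (Ioi t) = ∫⁻ β, ENNReal.ofReal (t ^ (-β)) ∂μ)
    (hW : IsSubordinator P W φ) (hl : 0 < l) (t : ℝ) :
    ENNReal.ofReal (h P W t l) = ENNReal.ofReal l * potential P W l (Ioi t) := by
  have h1 := hW.one_sub_h (levy_exponent_one_pos hμ hφ hW) hl t
  have h2 : potential P W l (Iic t) + potential P W l (Ioi t) = ENNReal.ofReal l⁻¹ := by
    rw [← hW.potential_univ hl, ← compl_Iic, measure_add_measure_compl measurableSet_Iic]
  have h3 : ENNReal.ofReal (1 - h P W t l) + ENNReal.ofReal l * potential P W l (Ioi t)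
      = ENNReal.ofReal (1 - h P W t l) + ENNReal.ofReal (h P W t l) := by
    rw [← ENNReal.ofReal_add (by linarith [h_le_one (P := P) (W := W) hl t]) (h_nonneg P W t l),
      h1, ← mul_add, h2, ← ENNReal.ofReal_mul hl.le, mul_inv_cancel₀ hl.ne']
    simp
  exact ((ENNReal.add_right_inj ENNReal.ofReal_ne_top).1 h3).symm

/-- The Laplace transform of `h`. -/
theorem laplace_h (hμ : μ (Ioo 0 1)ᶜ = 0)
    (hφ : ∀ t : ℝ, 0 < t → φ (Ioi t) = ∫⁻ β, ENNReal.ofReal (t ^ (-β)) ∂μ)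
    (hW : IsSubordinator P W φ) (hl : 0 < l) {s : ℝ} (hs : 0 < s) :
    ∫⁻ t in Ioi 0, ENNReal.ofReal (Real.exp (-s * t)) * ENNReal.ofReal (h P W t l)
      = (∫⁻ t in Ioi 0, ENNReal.ofReal (Real.exp (-s * t)) * φ (Ioi t))
        * ∫⁻ y, ENNReal.ofReal (Real.exp (-s * y)) ∂(potential P W l) := by
  have := isFiniteMeasure_orderMeasure hμ hφ hW.levy_support hW.levy_integrable
  set q := ∫ β, s ^ β ∂(orderMeasure μ) with hq
  have hq0 : 0 < q := integral_rpow_orderMeasure_pos hμ hs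
  have hψ := integral_one_sub_exp_levy hμ hφ hW.levy_support hs
  have hU := hW.laplace_potential (l := l) hs (by rw [hψ]; linarith)
  rw [hψ, ← hq] at hU
  have hφpos : ∀ᵐ y ∂φ, 0 ≤ y := by
    filter_upwards [measure_eq_zero_iff_ae_notMem.1 hW.levy_support] with y hy
    exact (not_le.1 hy).le
  have hφq : ∫⁻ y, ENNReal.ofReal (1 - Real.exp (-s * y)) ∂φ = ENNReal.ofReal q := by
    rw [lintegral_one_sub_exp_levy hμ hφ hW.levy_support hs, hq,
      ofReal_integral_eq_lintegral_ofReal]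
    · exact integrable_of_continuous (orderMeasure_compl hμ) (Real.continuous_const_rpow hs.ne')
    · exact Filter.Eventually.of_forall fun β => Real.rpow_nonneg hs.le β
  -- Total mass minus Laplace transform of the potential. Multiplied by `l / s`, it equals `q / (s
  -- (l + q))`, the product on the right.
  have hUq : ∫⁻ y, ENNReal.ofReal (1 - Real.exp (-s * y)) ∂(potential P W l)
      = ENNReal.ofReal (l⁻¹ - (l + q)⁻¹) := by
    have hsum : ∫⁻ y, ENNReal.ofReal (1 - Real.exp (-s * y)) ∂(potential P W l)
        + ENNReal.ofReal (l + q)⁻¹ = ENNReal.ofReal l⁻¹ := by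
      rw [← hU, ← lintegral_add_right _ (by fun_prop), ← hW.potential_univ hl, ← lintegral_one]
      refine lintegral_congr_ae ?_
      filter_upwards [hW.ae_potential_nonneg l] with y hy
      rw [← ENNReal.ofReal_add _ (Real.exp_nonneg _)]
      · simp
      · rw [sub_nonneg, Real.exp_le_one_iff]; nlinarith
    rw [ENNReal.ofReal_sub _ (by positivity)]
    exact ENNReal.eq_sub_of_add_eq ENNReal.ofReal_ne_top hsum
  rw [lintegral_exp_mul_tail hφpos hs, hφq, hU]
  simp only [ofReal_h hμ hφ hW hl, mul_left_comm _ (ENNReal.ofReal l)]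
  rw [lintegral_const_mul' _ _ ENNReal.ofReal_ne_top,
    lintegral_exp_mul_tail (hW.ae_potential_nonneg l) hs, hUq,
    ← ENNReal.ofReal_mul (by positivity), ← ENNReal.ofReal_mul (by positivity),
    ← ENNReal.ofReal_mul (by positivity), ← ENNReal.ofReal_mul (by positivity)]
  congr 1
  have : l + q ≠ 0 := by positivity
  field_simp
  ring

end Inverse

/-! ### Derivative of `h` and its convolution formula -/

section Main

variable {Ω : Type*} [MeasurableSpace Ω] {P : Measure Ω} [IsProbabilityMeasure P]
  {μ φ : Measure ℝ} [IsProbabilityMeasure μ] {W : ℝ≥0 → Ω → ℝ} {l : ℝ} {u : ℝ → ℝ}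

theorem integrableOn_density (hW : IsSubordinator P W φ) (hl : 0 < l)
    (hum : Measurable u) (hu0 : ∀ t, 0 ≤ u t)
    (hU : potential P W l = (volume.restrict (Ioi 0)).withDensity fun t => ENNReal.ofReal (u t)) :
    IntegrableOn u (Ioi 0) := by
  refine ⟨hum.aestronglyMeasurable, ?_⟩
  rw [hasFiniteIntegral_iff_ofReal (Filter.Eventually.of_forall hu0)]
  have h1 := hW.potential_univ hl
  rw [hU, withDensity_apply _ MeasurableSet.univ, Measure.restrict_univ] at h1
  rw [h1]
  exact ENNReal.ofReal_lt_top

theorem h_eq_one_sub_integral (hμ : μ (Ioo 0 1)ᶜ = 0)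
    (hφ : ∀ t : ℝ, 0 < t → φ (Ioi t) = ∫⁻ β, ENNReal.ofReal (t ^ (-β)) ∂μ)
    (hW : IsSubordinator P W φ) (hl : 0 < l) (hum : Measurable u) (hu0 : ∀ t, 0 ≤ u t)
    (hU : potential P W l = (volume.restrict (Ioi 0)).withDensity fun t => ENNReal.ofReal (u t))
    {t : ℝ} (ht : 0 ≤ t) : h P W t l = 1 - l * ∫ r in (0 : ℝ)..t, u r := by
  have hint := integrableOn_density hW hl hum hu0 hU
  have h1 := hW.one_sub_h (levy_exponent_one_pos hμ hφ hW) hl t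
  rw [hU, withDensity_apply _ measurableSet_Iic, Measure.restrict_restrict measurableSet_Iic,
    inter_comm, Ioi_inter_Iic, ← ofReal_integral_eq_lintegral_ofReal
      (hint.mono_set Ioc_subset_Ioi_self) (Filter.Eventually.of_forall hu0),
    ← intervalIntegral.integral_of_le ht, ← ENNReal.ofReal_mul hl.le,
    ENNReal.ofReal_eq_ofReal_iff (by linarith [h_le_one (P := P) (W := W) hl t])
      (mul_nonneg hl.le (intervalIntegral.integral_nonneg ht fun r _ => hu0 r))] at h1
  linarith

theorem continuousOn_h (hμ : μ (Ioo 0 1)ᶜ = 0)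
    (hφ : ∀ t : ℝ, 0 < t → φ (Ioi t) = ∫⁻ β, ENNReal.ofReal (t ^ (-β)) ∂μ)
    (hW : IsSubordinator P W φ) (hl : 0 < l) (hum : Measurable u) (hu0 : ∀ t, 0 ≤ u t)
    (hU : potential P W l = (volume.restrict (Ioi 0)).withDensity fun t => ENNReal.ofReal (u t))
    {t : ℝ} (ht : 0 ≤ t) : ContinuousOn (fun r => h P W r l) (Icc 0 t) := by
  have hint := integrableOn_density hW hl hum hu0 hU
  refine ContinuousOn.congr (f := fun r => 1 - l * ∫ x in (0 : ℝ)..r, u x) ?_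
    fun r hr => h_eq_one_sub_integral hμ hφ hW hl hum hu0 hU hr.1
  refine continuousOn_const.sub (continuousOn_const.mul ?_)
  rw [← uIcc_of_le ht]
  exact intervalIntegral.continuousOn_primitive_interval'
    ((intervalIntegrable_iff_integrableOn_Ioc_of_le ht).2 (hint.mono_set Ioc_subset_Ioi_self))
    left_mem_uIcc

theorem hasDerivAt_h (hμ : μ (Ioo 0 1)ᶜ = 0)
    (hφ : ∀ t : ℝ, 0 < t → φ (Ioi t) = ∫⁻ β, ENNReal.ofReal (t ^ (-β)) ∂μ)
    (hW : IsSubordinator P W φ) (hl : 0 < l) (hum : Measurable u) (hu0 : ∀ t, 0 ≤ u t)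
    (huc : ContinuousOn u (Ioi 0))
    (hU : potential P W l = (volume.restrict (Ioi 0)).withDensity fun t => ENNReal.ofReal (u t))
    {t : ℝ} (ht : 0 < t) : HasDerivAt (fun r => h P W r l) (-l * u t) t := by
  have hint := integrableOn_density hW hl hum hu0 hU
  have hI : IntervalIntegrable u volume 0 t :=
    (intervalIntegrable_iff_integrableOn_Ioc_of_le ht.le).2 (hint.mono_set Ioc_subset_Ioi_self)
  have h1 := intervalIntegral.integral_hasDerivAt_right hI
    hum.stronglyMeasurable.stronglyMeasurableAtFilter (huc.continuousAt (Ioi_mem_nhds ht))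
  have h2 := (h1.const_mul l).const_sub 1
  rw [← neg_mul] at h2
  refine h2.congr_of_eventuallyEq ?_
  filter_upwards [lt_mem_nhds ht] with r hr
  exact h_eq_one_sub_integral hμ hφ hW hl hum hu0 hU hr.le

/-- The function `h` is the convolution of the tail of the Lévy measure with the potential
density. -/
theorem ofReal_h_eq_convolution (hμ : μ (Ioo 0 1)ᶜ = 0)
    (hφ : ∀ t : ℝ, 0 < t → φ (Ioi t) = ∫⁻ β, ENNReal.ofReal (t ^ (-β)) ∂μ)
    (hW : IsSubordinator P W φ) (hl : 0 < l) (hum : Measurable u) (hu0 : ∀ t, 0 ≤ u t)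
    (huc : ContinuousOn u (Ioi 0)) (hua : AntitoneOn u (Ioi 0))
    (hU : potential P W l = (volume.restrict (Ioi 0)).withDensity fun t => ENNReal.ofReal (u t))
    {t : ℝ} (ht : 0 < t) : ENNReal.ofReal (h P W t l)
      = ∫⁻ y in Ioo 0 t, φ (Ioi (t - y)) * ENNReal.ofReal (u y) := by
  have hTm : Measurable fun t => φ (Ioi t) := measurable_levy_tail
  have hvm : Measurable fun t => ENNReal.ofReal (u t) := hum.ennreal_ofReal
  have hhc : ContinuousOn (fun r => ENNReal.ofReal (h P W r l)) (Ioi 0) := fun r hr =>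
    (ENNReal.continuous_ofReal.continuousAt.comp
      (hasDerivAt_h hμ hφ hW hl hum hu0 huc hU hr).continuousAt).continuousWithinAt
  have hlapU : ∀ s : ℝ, ∫⁻ y, ENNReal.ofReal (Real.exp (-s * y)) ∂(potential P W l)
      = ∫⁻ y in Ioi 0, ENNReal.ofReal (Real.exp (-s * y)) * ENNReal.ofReal (u y) := by
    intro s
    rw [hU, lintegral_withDensity_eq_lintegral_mul _ hvm (by fun_prop)]
    refine lintegral_congr fun y => ?_
    rw [mul_comm]; rfl
  have hhm : Measurable fun r => ENNReal.ofReal (h P W r l) := by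
    simp only [ofReal_h hμ hφ hW hl]
    exact measurable_levy_tail.const_mul _
  have hae : (fun r => ENNReal.ofReal (h P W r l)) =ᵐ[volume.restrict (Ioi 0)]
      fun t => ∫⁻ y in Ioo 0 t, φ (Ioi (t - y)) * ENNReal.ofReal (u y) := by
    refine ae_eq_of_laplace hhm (measurable_convolution hTm hvm) (fun s hs => ?_) fun s hs => ?_
    · refine ne_top_of_le_ne_top ?_ (lintegral_mono (g := fun t => ENNReal.ofReal (Real.exp (-s * t)))
        fun t => ?_)
      · rw [lintegral_exp_neg_mul_Ioi hs]; exact ENNReal.ofReal_ne_top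
      · refine mul_le_of_le_one_right' ?_
        exact ENNReal.ofReal_le_one.2 (h_le_one hl t)
    · rw [laplace_h hμ hφ hW hl hs, hlapU]
      exact (laplace_convolution hTm hvm s).symm
  have hfin : ∀ᵐ t ∂(volume.restrict (Ioi (0 : ℝ))),
      ∫⁻ y in Ioo 0 t, φ (Ioi (t - y)) * ENNReal.ofReal (u y) ≠ ∞ := by
    filter_upwards [hae] with t ht
    rw [← ht]
    exact ENNReal.ofReal_ne_top
  have hcc := continuousOn_convolution hTm hvm
    (fun x _ y _ hxy => measure_mono (Ioi_subset_Ioi hxy))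
    (fun x hx y hy hxy => ENNReal.ofReal_le_ofReal (hua hx hy hxy))
    (continuousOn_levy_tail hμ hφ) (ENNReal.continuous_ofReal.comp_continuousOn huc)
    (fun t ht => levy_tail_ne_top hμ hφ ht) (fun _ _ => ENNReal.ofReal_ne_top) hfin
  -- Both sides are continuous on `(0, ∞)`, so equality almost everywhere there is equality
  -- everywhere there.
  exact Measure.eqOn_open_of_ae_eq hae isOpen_Ioi hhc hcc ht

/-- Integrating `g` against `e^{-lx}` replaces the laws of `W_x` by the potential measure. Its
density lives on `(0, ∞)`, so there is no atom at `0` and `Ico` becomes `Ioo`. -/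
theorem lintegral_g (hW : IsSubordinator P W φ) (hum : Measurable u)
    (hU : potential P W l = (volume.restrict (Ioi 0)).withDensity fun t => ENNReal.ofReal (u t))
    (t : ℝ) : ∫⁻ x in Ioi (0 : ℝ), ENNReal.ofReal (Real.exp (-l * x)) * g P W φ t x.toNNReal
      = ∫⁻ y in Ioo 0 t, φ (Ioi (t - y)) * ENNReal.ofReal (u y) := by
  have hTm : Measurable fun y => φ (Ioi (t - y)) :=
    (measurable_levy_tail (φ := φ)).comp (measurable_const.sub measurable_id)
  have h1 := hW.lintegral_potential l (hTm.indicator (measurableSet_Ico (a := 0) (b := t)))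
  simp only [lintegral_indicator measurableSet_Ico] at h1
  simp only [g]
  rw [← h1, hU, restrict_withDensity measurableSet_Ico,
    Measure.restrict_restrict measurableSet_Ico,
    lintegral_withDensity_eq_lintegral_mul _ hum.ennreal_ofReal hTm]
  have hset : Ico 0 t ∩ Ioi 0 = Ioo 0 t := by
    ext y; simp only [mem_inter_iff, mem_Ico, mem_Ioi, mem_Ioo]
    exact ⟨fun h => ⟨h.2, h.1.2⟩, fun h => ⟨⟨h.1.le, h.2⟩, h.1⟩⟩
  rw [hset]
  exact lintegral_congr fun y => mul_comm _ _

end Main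

/-! ### Caputo integrals and the final equation -/

/-- `u` may be singular at `0` and the kernel is singular at `t`. On each side of `t / 2` one factor
is bounded by its value at `t / 2`; the sum of the two resulting bounds dominates throughout. -/
theorem integrableOn_mul_rpow_sub {u : ℝ → ℝ} (hum : Measurable u) (hu0 : ∀ t, 0 ≤ u t)
    (hua : AntitoneOn u (Ioi 0)) {t : ℝ} (ht : 0 < t) (hint : IntegrableOn u (Ioc 0 t))
    {β : ℝ} (hβ : β ∈ Ioo (0 : ℝ) 1) : IntegrableOn (fun r => u r / (t - r) ^ β) (Ioc 0 t) := by
  have h1 : IntegrableOn (fun r : ℝ => (t - r) ^ (-β)) (Ioc 0 t) := by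
    have h2 : IntervalIntegrable (fun r : ℝ => r ^ (-β)) volume t 0 :=
      intervalIntegral.intervalIntegrable_rpow' (by linarith [hβ.2])
    have h3 := h2.comp_sub_left t
    rw [sub_self, sub_zero] at h3
    exact (intervalIntegrable_iff_integrableOn_Ioc_of_le ht.le).1 h3
  refine Integrable.mono' ((hint.mul_const ((t / 2) ^ (-β))).add (h1.const_mul (u (t / 2))))
    (hum.div (by fun_prop)).aestronglyMeasurable ?_
  filter_upwards [self_mem_ae_restrict measurableSet_Ioc] with r hr
  have hr0 : 0 ≤ t - r := sub_nonneg.2 hr.2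
  have hp : 0 ≤ (t - r) ^ (-β) := Real.rpow_nonneg hr0 _
  rw [Real.norm_of_nonneg (div_nonneg (hu0 r) (Real.rpow_nonneg hr0 _)), div_eq_mul_inv,
    ← Real.rpow_neg hr0]
  simp only [Pi.add_apply]
  rcases le_total r (t / 2) with hle | hle
  · have : (t - r) ^ (-β) ≤ (t / 2) ^ (-β) :=
      Real.rpow_le_rpow_of_nonpos (half_pos ht) (by linarith) (by linarith [hβ.1])
    have h4 := mul_le_mul_of_nonneg_left this (hu0 r)
    have h5 := mul_nonneg (hu0 (t / 2)) hp
    linarith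
  · have h4 := mul_le_mul_of_nonneg_right (hua (half_pos ht) hr.1 hle) hp
    have h5 := mul_nonneg (hu0 r) (Real.rpow_nonneg (half_pos ht).le (-β))
    linarith

/-- The integral of the Caputo integrals over `β` is the convolution with the tail. -/
theorem integral_caputo_integral {μ φ : Measure ℝ} [IsProbabilityMeasure μ]
    (hφ : ∀ t : ℝ, 0 < t → φ (Ioi t) = ∫⁻ β, ENNReal.ofReal (t ^ (-β)) ∂μ)
    {u : ℝ → ℝ} (hum : Measurable u) (hu0 : ∀ t, 0 ≤ u t) {t c : ℝ} (hc : 0 ≤ c)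
    (hconv : ENNReal.ofReal c = ∫⁻ y in Ioo 0 t, φ (Ioi (t - y)) * ENNReal.ofReal (u y)) :
    Integrable (fun β => ∫ r in Ioc 0 t, u r / (t - r) ^ β) μ ∧
      ∫ β, (∫ r in Ioc 0 t, u r / (t - r) ^ β) ∂μ = c := by
  set J : ℝ → ℝ≥0∞ := fun β => ∫⁻ r in Ioo 0 t,
    ENNReal.ofReal ((t - r) ^ (-β)) * ENNReal.ofReal (u r) with hJ
  have hJm : Measurable J := by
    refine Measurable.lintegral_prod_right (f := fun β r : ℝ =>
      ENNReal.ofReal ((t - r) ^ (-β)) * ENNReal.ofReal (u r)) ?_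
    fun_prop
  have hJint : ∀ β, ∫ r in Ioc 0 t, u r / (t - r) ^ β = (J β).toReal := by
    intro β
    rw [integral_Ioc_eq_integral_Ioo, integral_eq_lintegral_of_nonneg_ae]
    · congr 1
      refine setLIntegral_congr_fun measurableSet_Ioo fun r hr => ?_
      have hr0 : 0 ≤ t - r := sub_nonneg.2 hr.2.le
      rw [← ENNReal.ofReal_mul (Real.rpow_nonneg hr0 _), Real.rpow_neg hr0, div_eq_inv_mul]
    · filter_upwards [self_mem_ae_restrict measurableSet_Ioo] with r hr
      exact div_nonneg (hu0 r) (Real.rpow_nonneg (sub_nonneg.2 hr.2.le) _)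
    · exact (hum.div (by fun_prop)).aestronglyMeasurable
  have hJtot : ∫⁻ β, J β ∂μ = ENNReal.ofReal c := by
    rw [hconv, hJ, lintegral_lintegral_swap (by fun_prop)]
    refine setLIntegral_congr_fun measurableSet_Ioo fun r hr => ?_
    rw [lintegral_mul_const _ (by fun_prop), hφ _ (sub_pos.2 hr.2)]
  have hne : ∫⁻ β, J β ∂μ ≠ ∞ := hJtot ▸ ENNReal.ofReal_ne_top
  simp only [hJint]
  refine ⟨integrable_toReal_of_lintegral_ne_top hJm.aemeasurable hne, ?_⟩
  rw [integral_toReal hJm.aemeasurable (ae_lt_top hJm hne), hJtot, ENNReal.toReal_ofReal hc]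

end DistributedOrder

open MeasureTheory Set DistributedOrder in
theorem mainTheorem6 {Ω : Type*} [MeasurableSpace Ω] (P : Measure Ω) [IsProbabilityMeasure P]
    (μ : Measure ℝ) [IsProbabilityMeasure μ] (hμ : μ (Ioo 0 1)ᶜ = 0)
    (hμ' : ∫⁻ β, ENNReal.ofReal (1 / (1 - β)) ∂μ < ∞)
    (φ : Measure ℝ)
    (hφ : ∀ t : ℝ, 0 < t → φ (Ioi t) = ∫⁻ β, ENNReal.ofReal (t ^ (-β)) ∂μ)
    (W : ℝ≥0 → Ω → ℝ) (hW : IsSubordinator P W φ)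
    (l : ℝ) (hl : 0 < l) :
    (∀ t : ℝ, 0 < t →
      ENNReal.ofReal (h P W t l)
        = ∫⁻ x in Ioi (0 : ℝ), ENNReal.ofReal (Real.exp (-l * x)) * g P W φ t x.toNNReal) ∧
    (∀ t : ℝ, 0 < t →
      DistributedDifferentiableAt (orderMeasure μ) (fun r => h P W r l) t ∧
      distributedDeriv (orderMeasure μ) (fun r => h P W r l) t = -l * h P W t l) ∧
    h P W 0 l = 1 := by
  obtain ⟨u, hum, hu0, huc, hua, hU⟩ := exists_potential_density hμ hφ hW hl
  have hint := integrableOn_density hW hl hum hu0 hU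
  refine ⟨fun t ht => ?_, fun t ht => ?_, ?_⟩
  · rw [lintegral_g hW hum hU t]
    exact ofReal_h_eq_convolution hμ hφ hW hl hum hu0 huc hua hU ht
  · have hderiv : ∀ r, 0 < r → deriv (fun r => h P W r l) r = -l * u r := fun r hr =>
      (hasDerivAt_h hμ hφ hW hl hum hu0 huc hU hr).deriv
    have hintt : IntegrableOn u (Ioc 0 t) := hint.mono_set Ioc_subset_Ioi_self
    -- The formula for the derivative is available only for `r > 0`, so the integrands are compared
    -- on `Ioc 0 t`.
    have hquot : ∀ β : ℝ, EqOn (fun r => -l * (u r / (t - r) ^ β))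
        (fun r => deriv (fun r => h P W r l) r / (t - r) ^ β) (Ioc 0 t) := fun β r hr => by
      simp only
      rw [hderiv r hr.1, mul_div_assoc]
    have hcap : ∀ β, caputoDeriv β (fun r => h P W r l) t = 1 / Real.Gamma (1 - β)
        * (-l * ∫ r in Ioc 0 t, u r / (t - r) ^ β) := fun β => by
      rw [caputoDeriv, intervalIntegral.integral_of_le ht.le,
        ← setIntegral_congr_fun measurableSet_Ioc (hquot β), integral_const_mul]
    obtain ⟨hJi, hJ⟩ := integral_caputo_integral hφ hum hu0 (h_nonneg P W t l)
      (ofReal_h_eq_convolution hμ hφ hW hl hum hu0 huc hua hU ht)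
    have hGm : Measurable fun β : ℝ => ENNReal.ofReal (Real.Gamma (1 - β)) :=
      measurable_gamma_one_sub.ennreal_ofReal
    have hGt : ∀ᵐ β ∂μ, ENNReal.ofReal (Real.Gamma (1 - β)) < ∞ :=
      Filter.Eventually.of_forall fun _ => ENNReal.ofReal_lt_top
    -- The density `Γ(1 - β)` of `ν` cancels the Caputo normalisation, leaving an integral against
    -- `μ` alone.
    have hweight : (fun β => (ENNReal.ofReal (Real.Gamma (1 - β))).toReal
        • caputoDeriv β (fun r => h P W r l) t)
        =ᵐ[μ] fun β => -l * ∫ r in Ioc 0 t, u r / (t - r) ^ β := by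
      filter_upwards [ae_mem_Ioo hμ] with β hβ
      have hG : 0 < Real.Gamma (1 - β) := Real.Gamma_pos_of_pos (by linarith [hβ.2])
      rw [ENNReal.toReal_ofReal hG.le, smul_eq_mul, hcap β, ← mul_assoc, mul_one_div_cancel hG.ne',
        one_mul]
    have hres : (orderMeasure μ).restrict (Ioo 0 1) = orderMeasure μ :=
      Measure.restrict_eq_self_of_ae_mem (ae_mem_Ioo (orderMeasure_compl hμ))
    refine ⟨⟨continuousOn_h hμ hφ hW hl hum hu0 hU ht.le, fun r hr =>
      (hasDerivAt_h hμ hφ hW hl hum hu0 huc hU hr.1).differentiableAt, ?_, fun β hβ => ?_, ?_⟩, ?_⟩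
    · rw [intervalIntegrable_iff_integrableOn_Ioc_of_le ht.le]
      exact IntegrableOn.congr_fun (hintt.const_mul (-l)) (fun r hr => (hderiv r hr.1).symm) measurableSet_Ioc
    · rw [intervalIntegrable_iff_integrableOn_Ioc_of_le ht.le]
      exact IntegrableOn.congr_fun
        ((integrableOn_mul_rpow_sub hum hu0 hua ht hintt hβ).const_mul (-l)) (hquot β) measurableSet_Ioc
    · rw [IntegrableOn, hres, orderMeasure,
        integrable_withDensity_iff_integrable_smul₀' hGm.aemeasurable hGt]
      exact (hJi.const_mul (-l)).congr hweight.symm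
    · rw [distributedDeriv, hres, orderMeasure,
        integral_withDensity_eq_integral_toReal_smul₀ hGm.aemeasurable hGt,
        integral_congr_ae hweight, integral_const_mul, hJ]
  · rw [h_eq_one_sub_integral hμ hφ hW hl hum hu0 hU le_rfl]
    simp
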